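/- **Setting.** Fix $p\ge 1$, a vector $u\in\mathbb R^p\setminus\{0\}$, a level $\alpha\in(0,1)$, and constants $\lambda_{\mathrm{reg}},K_{\mathrm{reg}},K_\varepsilon,K_\xi>0$. For matrices, $\|\cdot\|$ is the spectral norm, $A^\dagger$ is the Moore–Penrose pseudo-inverse and $\mathrm{vec}$ is vectorization; for vectors, $\|\cdot\|$ is the Euclidean norm. $\Phi$, $\varphi$ and $q$ are the c.d.f., density and quantile function of $\mathcal N(0,1)$. **Model.** $\Theta$ is the set of pairs $\theta=(\beta_0,P_{X,\varepsilon})$ with $\beta_0\in\mathbb R^p$ and $P_{X,\varepsilon}$ a probability distribution on $\mathbb R^p\times\mathbb R$ such that $\mathbb E[X\varepsilon]=0$, $\mathbb E\|X\|^4<\infty$, $\lambda_{\min}(\mathbb E[XX'])>0$, $\lambda_{\min}(\mathbb E[XX'\varepsilon^2])>0$ and $\lambda_{\max}(\mathbb E[XX'\varepsilon^2])<\infty$. $P_\theta$ is the law of $(X,Y)$ with $Y=X'\beta_0+\varepsilon$. Let $\widetilde X=\mathbb E[XX']^{-1/2}X$ and $\xi=u'\,\mathbb E[XX']^{-1}X\varepsilon$.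 $\Theta_{\mathrm{EE}}$ is the set of $\theta\in\Theta$ with (i) $\lambda_{\min}(\mathbb E[XX'])\ge\lambda_{\mathrm{reg}}$; (ii) $\mathbb E\|\mathrm{vec}(\widetilde X\widetilde X'-I_p)\|^2\le K_{\mathrm{reg}}$; (iii) $\mathbb E\|\widetilde X\varepsilon\|^4\le K_\varepsilon$; (iv) $\mathbb E[\xi^4]/\mathbb E[\xi^2]^2\le K_\xi$. **Distances to normality.** With $\xi_1,\dots,\xi_n$ i.i.d. copies of $\xi$, $\sigma^2=\mathrm{Var}(\xi)$, $\lambda_3=\mathbb E[(\xi-\mathbb E\xi)^3]/\sigma^3$ and $S_n=\sum_{i\le n}(\xi_i-\mathbb E\xi)/(\sigma\sqrt n)$, let $$\Delta_{n,\mathrm B}(\theta)=\sup_{x\in\mathbb R}\big|\mathbb P_\theta(S_n\le x)-\Phi(x)\big|,\qquad \Delta_{n,\mathrm E}(\theta)=\sup_{x\in\mathbb R}\Big|\mathbb P_\theta(S_n\le x)-\Phi(x)-\tfrac{\lambda_3}{6\sqrt n}(1-x^2)\varphi(x)\Big|.$$ **Estimators.** From $n$ i.i.d. observations $(X_i,Y_i)\sim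 P_\theta$ put $S=\frac1n\sum_i X_iX_i'$, $\widehat\beta=S^\dagger\frac1n\sum_iX_iY_i$, $\widehat\varepsilon_i=Y_i-X_i'\widehat\beta$ and $\widehat V=S^\dagger\big(\frac1n\sum_iX_iX_i'\widehat\varepsilon_i^{\,2}\big)S^\dagger$. For $\gamma>0$ let $\widetilde\gamma=\sqrt{K_{\mathrm{reg}}/(n\gamma)}$, $$R_{n,\mathrm{lin}}(\gamma)=\sqrt2\,\|u\|\,\lambda_{\mathrm{reg}}^{-1/2}\,\frac{\widetilde\gamma}{1-\widetilde\gamma}\Big(\frac{K_\varepsilon}{\gamma}\Big)^{1/4},$$ $$\begin{aligned}R_{n,\mathrm{var}}(\gamma)={}&\frac{2}{n\lambda_{\mathrm{reg}}^3}\Big(\frac{\widetilde\gamma}{1-\widetilde\gamma}+1\Big)^2\sqrt{\frac{K_\varepsilon}{\gamma}}\cdot\frac1n\sum_i\|X_i\|^4+\frac{2\sqrt2}{\lambda_{\mathrm{reg}}^{5/2}\sqrt n}\Big(\frac{\widetilde\gamma}{1-\widetilde\gamma}+1\Big)\Big(\frac{K_\varepsilon}{\gamma}\Big)^{1/4}\cdot\frac1n\sum_i\|X_i\|^3|\widehat\varepsilon_i|\\&+\frac{K_{\mathrm{reg}}/(n\gamma)}{\lambda_{\mathrm{reg}}^2(1-\widetilde\gamma)^2}\cdot\frac1n\sum_i\|X_i\widehat\varepsilon_i\|^2+\frac{2\widetilde\gamma}{\lambda_{\mathrm{reg}}(1-\widetilde\gamma)}\Big\|\frac1n\sum_iX_iX_i'S^\dagger\widehat\varepsilon_i^{\,2}\Big\|.\end{aligned}$$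 **Interval.** Given real sequences $(\delta_m),(a_m),(\omega_m)$, let $$\nu_m^{\mathrm{Edg}}=\tfrac12\Big(\omega_m\alpha+\exp\big(-m(1-1/a_m)^2/(2K_\xi)\big)\Big)+\delta_m,$$ $$n_0=\max\{m\ge1:\ m\le 2K_{\mathrm{reg}}/(\omega_m\alpha)\ \text{or}\ \nu_m^{\mathrm{Edg}}\ge\alpha/2\}$$ ($n_0=0$ if this set is empty, $n_0=\infty$ if it is unbounded). With $\gamma_n=\omega_n\alpha/2$ and $D_n=u'\widehat Vu+\|u\|^2R_{n,\mathrm{var}}(\gamma_n)$, put $\mathrm{CI}_u^{\mathrm{Edg}}(1-\alpha,n)=\mathbb R$ if $n\le n_0$, and otherwise $$\mathrm{CI}_u^{\mathrm{Edg}}(1-\alpha,n)=\Big[u'\widehat\beta\pm\frac{\sqrt{a_n}\,q(1-\alpha/2+\nu_n^{\mathrm{Edg}})\sqrt{D_n}+R_{n,\mathrm{lin}}(\gamma_n)}{\sqrt n}\Big].$$ (Equivalently, when $D_n>0$, the half-width is $Q_n^{\mathrm{Edg}}\sqrt{D_n}/\sqrt n$ with $Q_n^{\mathrm{Edg}}=\sqrt{a_n}\,q(1-\alpha/2+\nu_n^{\mathrm{Edg}})+R_{n,\mathrm{lin}}(\gamma_n)/\sqrt{D_n}$.)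 **Theorem.** Let $n\ge1$ and suppose that $\delta_n\ge\sup_{\theta\in\Theta_{\mathrm{EE}}}\min\{\Delta_{n,\mathrm E}(\theta),\Delta_{n,\mathrm B}(\theta)\}$, $a_n>1$ and $\omega_n\in(0,1)$. Then, for every $\theta=(\beta_0,P_{X,\varepsilon})\in\Theta_{\mathrm{EE}}$, the event $\{u'\beta_0\in\mathrm{CI}_u^{\mathrm{Edg}}(1-\alpha,n)\}$ is measurable and $$\mathbb P_\theta\big(u'\beta_0\in\mathrm{CI}_u^{\mathrm{Edg}}(1-\alpha,n)\big)\ge1-\alpha .$$ In particular, if the three conditions hold for every $n\ge1$, then $\mathrm{CI}_u^{\mathrm{Edg}}$ is non-asymptotically valid over $\Theta_{\mathrm{EE}}$ at level $1-\alpha$. -/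

import Mathlib

open MeasureTheory ProbabilityTheory Matrix

namespace OLS

/-! ### Linear algebra -/

/-- The four Penrose equations: `B` is a Moore-Penrose pseudo-inverse of the real matrix `A`. -/
structure IsMoorePenrose {p : ℕ} (A B : Matrix (Fin p) (Fin p) ℝ) : Prop where
  mul_mul_self : A * B * A = A
  mul_self_mul : B * A * B = B
  symm_left : (A * B)ᵀ = A * B
  symm_right : (B * A)ᵀ = B * A

theorem IsMoorePenrose.unique {p : ℕ} {A B C : Matrix (Fin p) (Fin p) ℝ}
    (hB : IsMoorePenrose A B) (hC : IsMoorePenrose A C) : B = C := by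
  have h1 : A * B = A * C := by
    calc A * B = (A * C * A) * B := by rw [hC.mul_mul_self]
      _ = (A * C) * (A * B) := by simp only [Matrix.mul_assoc]
      _ = (A * C)ᵀ * (A * B)ᵀ := by rw [hC.symm_left, hB.symm_left]
      _ = ((A * B * A) * C)ᵀ := by rw [← Matrix.transpose_mul]; simp only [Matrix.mul_assoc]
      _ = A * C := by rw [hB.mul_mul_self, hC.symm_left]
  have h2 : B * A = C * A := by
    calc B * A = B * (A * C * A) := by rw [hC.mul_mul_self]
      _ = (B * A) * (C * A) := by simp only [Matrix.mul_assoc]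
      _ = (B * A)ᵀ * (C * A)ᵀ := by rw [hC.symm_right, hB.symm_right]
      _ = (C * (A * B * A))ᵀ := by rw [← Matrix.transpose_mul]; simp only [Matrix.mul_assoc]
      _ = C * A := by rw [hB.mul_mul_self, hC.symm_right]
  calc B = B * A * B := hB.mul_self_mul.symm
    _ = C * (A * B) := by rw [h2, Matrix.mul_assoc]
    _ = C := by rw [h1, ← Matrix.mul_assoc, hC.mul_self_mul]

theorem exists_isMoorePenrose_of_isHermitian {p : ℕ} {A : Matrix (Fin p) (Fin p) ℝ}
    (hA : A.IsHermitian) : ∃ B, IsMoorePenrose A B := by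
  have hs : IsSelfAdjoint A := hA.isSelfAdjoint
  have hc : ∀ f : ℝ → ℝ, ContinuousOn f (spectrum ℝ A) := fun f =>
    (Matrix.finite_real_spectrum (A := A)).continuousOn f
  have hid : cfc (fun x : ℝ => x) A = A := cfc_id' ℝ A
  have hsymm : ∀ f : ℝ → ℝ, (cfc f A)ᵀ = cfc f A := fun f => by
    have h : IsSelfAdjoint (cfc f A) := cfc_predicate f A
    simpa [Matrix.star_eq_conjTranspose, Matrix.conjTranspose_eq_transpose_of_trivial] using
      h.star_eq
  have hl : A * cfc (fun x : ℝ => x⁻¹) A = cfc (fun x : ℝ => x * x⁻¹) A := by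
    rw [cfc_mul (fun x : ℝ => x) (fun x : ℝ => x⁻¹) A (hc _) (hc _), hid]
  have hr : cfc (fun x : ℝ => x⁻¹) A * A = cfc (fun x : ℝ => x⁻¹ * x) A := by
    rw [cfc_mul (fun x : ℝ => x⁻¹) (fun x : ℝ => x) A (hc _) (hc _), hid]
  refine ⟨cfc (fun x : ℝ => x⁻¹) A, ?_, ?_, ?_, ?_⟩
  · rw [hl]
    nth_rewrite 2 [← hid]
    rw [← cfc_mul (fun x : ℝ => x * x⁻¹) (fun x : ℝ => x) A (hc _) (hc _)]
    simp only [mul_inv_mul_cancel, hid]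
  · rw [hr, ← cfc_mul (fun x : ℝ => x⁻¹ * x) (fun x : ℝ => x⁻¹) A (hc _) (hc _)]
    congr 1
    funext x
    by_cases hx : x = 0 <;> simp [hx]
  · rw [hl, hsymm]
  · rw [hr, hsymm]

/-- Every real square matrix has a (unique) Moore-Penrose pseudo-inverse. -/
theorem exists_isMoorePenrose {p : ℕ} (A : Matrix (Fin p) (Fin p) ℝ) :
    ∃ B, IsMoorePenrose A B := by
  have hH : (Aᵀ * A).IsHermitian := by
    simpa [Matrix.conjTranspose_eq_transpose_of_trivial] using
      Matrix.isHermitian_conjTranspose_mul_self A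
  obtain ⟨G, hG⟩ := exists_isMoorePenrose_of_isHermitian hH
  have hHt : (Aᵀ * A)ᵀ = Aᵀ * A := by simp
  have hGt : IsMoorePenrose (Aᵀ * A) Gᵀ := by
    refine ⟨?_, ?_, ?_, ?_⟩
    · have := congrArg Matrix.transpose hG.mul_mul_self
      simpa only [Matrix.transpose_mul, Matrix.transpose_transpose, Matrix.mul_assoc] using this
    · have := congrArg Matrix.transpose hG.mul_self_mul
      simpa only [Matrix.transpose_mul, Matrix.transpose_transpose, Matrix.mul_assoc] using this
    · have h := hG.symm_right
      rw [Matrix.transpose_mul, hHt] at h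
      rw [Matrix.transpose_mul, hHt, Matrix.transpose_transpose, h]
    · have h := hG.symm_left
      rw [Matrix.transpose_mul, hHt] at h
      rw [Matrix.transpose_mul, hHt, Matrix.transpose_transpose, h]
  have hsym : Gᵀ = G := hGt.unique hG
  have key : A * (G * (Aᵀ * A)) - A = 0 := by
    set M := A * (G * (Aᵀ * A)) - A with hM
    have h0 : Aᵀ * M = 0 := by
      have : Aᵀ * M = (Aᵀ * A) * G * (Aᵀ * A) - Aᵀ * A := by
        rw [hM, Matrix.mul_sub]; simp only [Matrix.mul_assoc]
      rw [this, hG.mul_mul_self, sub_self]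
    have h1 : Mᵀ * M = 0 := by
      have : Mᵀ = (G * (Aᵀ * A))ᵀ * Aᵀ - Aᵀ := by
        rw [hM, Matrix.transpose_sub, Matrix.transpose_mul]
      rw [this, Matrix.sub_mul, Matrix.mul_assoc, h0]; simp
    have h2 : Mᴴ * M = 0 := by
      rw [Matrix.conjTranspose_eq_transpose_of_trivial]; exact h1
    exact Matrix.conjTranspose_mul_self_eq_zero.mp h2
  refine ⟨G * Aᵀ, ?_, ?_, ?_, ?_⟩
  · have := sub_eq_zero.mp key
    simpa only [Matrix.mul_assoc] using this
  · have := congrArg (fun Z => Z * Aᵀ) hG.mul_self_mul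
    simpa only [Matrix.mul_assoc] using this
  · simp only [Matrix.transpose_mul, Matrix.transpose_transpose, hsym, Matrix.mul_assoc]
  · have := hG.symm_right
    simpa only [Matrix.mul_assoc] using this

/-- The Moore-Penrose pseudo-inverse `A†`. -/
noncomputable def pinv {p : ℕ} (A : Matrix (Fin p) (Fin p) ℝ) : Matrix (Fin p) (Fin p) ℝ :=
  (exists_isMoorePenrose A).choose

theorem pinv_isMoorePenrose {p : ℕ} (A : Matrix (Fin p) (Fin p) ℝ) :
    IsMoorePenrose A (pinv A) :=
  (exists_isMoorePenrose A).choose_spec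

/-- Smallest eigenvalue of a symmetric real matrix. -/
noncomputable def lamMin {p : ℕ} (A : Matrix (Fin p) (Fin p) ℝ) : ℝ := sInf (spectrum ℝ A)

/-- `A ^ (-1/2)` for a symmetric positive definite matrix, by the functional calculus. -/
noncomputable def invSqrt {p : ℕ} (A : Matrix (Fin p) (Fin p) ℝ) : Matrix (Fin p) (Fin p) ℝ :=
  cfc (fun x : ℝ => (√x)⁻¹) A

/-- Spectral norm (operator norm induced by the Euclidean norm). -/
noncomputable def specNorm {p : ℕ} (A : Matrix (Fin p) (Fin p) ℝ) : ℝ :=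
  ‖Matrix.toEuclideanCLM (n := Fin p) (𝕜 := ℝ) A‖

/-- The matrix `x x'`. -/
def outer {p : ℕ} (x : EuclideanSpace ℝ (Fin p)) : Matrix (Fin p) (Fin p) ℝ :=
  Matrix.of fun i j => x i * x j

/-- Matrix-vector product in Euclidean space. -/
def mulV {p : ℕ} (A : Matrix (Fin p) (Fin p) ℝ) (x : EuclideanSpace ℝ (Fin p)) :
    EuclideanSpace ℝ (Fin p) :=
  WithLp.toLp 2 (A *ᵥ x.ofLp)

/-! ### Distances to normality -/

/-- Distribution function of the standard Gaussian law. -/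
noncomputable def Phi (x : ℝ) : ℝ := cdf (gaussianReal 0 1) x

/-- Quantile of order `τ ∈ (0,1)` of the standard Gaussian law. -/
noncomputable def gaussQuantile (τ : ℝ) : ℝ := sInf {x : ℝ | τ ≤ Phi x}

/-- Standard deviation of a law on the line. -/
noncomputable def sigma (ν : Measure ℝ) : ℝ := √(variance id ν)

/-- Standardized third moment (skewness) of a law on the line. -/
noncomputable def lambda3 (ν : Measure ℝ) : ℝ :=
  ∫ v, (v - ∫ w, w ∂ν) ^ 3 / sigma ν ^ 3 ∂ν

/-- `P(S_n ≤ x)`, where `S_n` is the standardized sum of `n` i.i.d. variables with law `ν`. -/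
noncomputable def cdfStdSum (n : ℕ) (ν : Measure ℝ) (x : ℝ) : ℝ :=
  (Measure.pi fun _ : Fin n => ν).real
    {v | (∑ i, (v i - ∫ w, w ∂ν)) / (sigma ν * √(n : ℝ)) ≤ x}

/-- Berry-Esseen distance. -/
noncomputable def deltaB (n : ℕ) (ν : Measure ℝ) : ℝ :=
  ⨆ x : ℝ, |cdfStdSum n ν x - Phi x|

/-- Edgeworth distance. -/
noncomputable def deltaE (n : ℕ) (ν : Measure ℝ) : ℝ :=
  ⨆ x : ℝ, |cdfStdSum n ν x - Phi x
    - lambda3 ν / (6 * √(n : ℝ)) * (1 - x ^ 2) * gaussianPDFReal 0 1 x|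

/-! ### The linear model -/

/-- A parameter `θ = (β₀, P_{X,ε})`. -/
structure Param (p : ℕ) where
  beta : EuclideanSpace ℝ (Fin p)
  law : ProbabilityMeasure (EuclideanSpace ℝ (Fin p) × ℝ)

namespace Param

variable {p : ℕ} (θ : Param p)

/-- `P_{X,ε}` as a measure. -/
def meas : Measure (EuclideanSpace ℝ (Fin p) × ℝ) := (θ.law : Measure _)

/-- `P_θ`, the law of `(X, Y)` where `Y = X'β₀ + ε`. -/
noncomputable def obsLaw : Measure (EuclideanSpace ℝ (Fin p) × ℝ) :=
  θ.meas.map fun z => (z.1, inner ℝ z.1 θ.beta + z.2)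

/-- `E[X X']`. -/
noncomputable def secondMoment : Matrix (Fin p) (Fin p) ℝ :=
  Matrix.of fun i j => ∫ z, outer z.1 i j ∂θ.meas

/-- `E[X X' ε²]`. -/
noncomputable def scoreMoment : Matrix (Fin p) (Fin p) ℝ :=
  Matrix.of fun i j => ∫ z, outer z.1 i j * z.2 ^ 2 ∂θ.meas

/-- The rotated regressor `E[X X']^{-1/2} x`. -/
noncomputable def rot (x : EuclideanSpace ℝ (Fin p)) : EuclideanSpace ℝ (Fin p) :=
  mulV (invSqrt θ.secondMoment) x

/-- `ξ = u' E[X X']⁻¹ X ε`, as a function of `z = (X, ε)`. -/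
noncomputable def xi (u : EuclideanSpace ℝ (Fin p)) (z : EuclideanSpace ℝ (Fin p) × ℝ) : ℝ :=
  inner ℝ u (mulV θ.secondMoment⁻¹ z.1) * z.2

/-- The law of `ξ`. -/
noncomputable def xiLaw (u : EuclideanSpace ℝ (Fin p)) : Measure ℝ := θ.meas.map (θ.xi u)

end Param

/-- The parameter set `Θ` of the linear model. Integrability of `‖X‖² ε²` is the finiteness of
the largest eigenvalue of `E[X X' ε²]`; it makes `X ε` integrable. -/
def modelSet (p : ℕ) : Set (Param p) :=
  {θ | Integrable (fun z => ‖z.1‖ ^ 2 * z.2 ^ 2) θ.meas ∧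
    ∫ z, z.2 • z.1 ∂θ.meas = 0 ∧
    Integrable (fun z => ‖z.1‖ ^ 4) θ.meas ∧
    0 < lamMin θ.secondMoment ∧
    0 < lamMin θ.scoreMoment}

/-- The four constants that delineate `Θ_EE`. -/
structure Bounds where
  lamReg : ℝ
  KReg : ℝ
  KEps : ℝ
  KXi : ℝ

/-- The parameter set `Θ_EE`. -/
def thetaEE {p : ℕ} (u : EuclideanSpace ℝ (Fin p)) (K : Bounds) : Set (Param p) :=
  {θ | θ ∈ modelSet p ∧
    K.lamReg ≤ lamMin θ.secondMoment ∧
    ∫ z, ‖WithLp.toLp 2 (Matrix.vec (outer (θ.rot z.1) - 1))‖ ^ 2 ∂θ.meas ≤ K.KReg ∧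
    (Integrable (fun z => ‖z.2 • θ.rot z.1‖ ^ 4) θ.meas ∧
      ∫ z, ‖z.2 • θ.rot z.1‖ ^ 4 ∂θ.meas ≤ K.KEps) ∧
    (∫ z, θ.xi u z ^ 4 ∂θ.meas) / (∫ z, θ.xi u z ^ 2 ∂θ.meas) ^ 2 ≤ K.KXi}

/-! ### Estimators, computed from a sample `D i = (X_i, Y_i)` -/

section Sample

variable {p n : ℕ} (D : Fin n → EuclideanSpace ℝ (Fin p) × ℝ)

/-- `S = n⁻¹ ∑ X_i X_i'`. -/
noncomputable def gram : Matrix (Fin p) (Fin p) ℝ := (n : ℝ)⁻¹ • ∑ i, outer (D i).1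

/-- The OLS estimator. -/
noncomputable def betaHat : EuclideanSpace ℝ (Fin p) :=
  mulV (pinv (gram D)) ((n : ℝ)⁻¹ • ∑ i, (D i).2 • (D i).1)

/-- The residuals. -/
noncomputable def resid (i : Fin n) : ℝ := (D i).2 - inner ℝ (D i).1 (betaHat D)

/-- The heteroskedasticity-robust estimator of the asymptotic variance. -/
noncomputable def VHat : Matrix (Fin p) (Fin p) ℝ :=
  pinv (gram D) * ((n : ℝ)⁻¹ • ∑ i, resid D i ^ 2 • outer (D i).1) * pinv (gram D)

/-- `√(K_reg / (n γ))`. -/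
noncomputable def gammaTilde (K : Bounds) (n : ℕ) (γ : ℝ) : ℝ := √(K.KReg / (n * γ))

/-- The linearization remainder `R_{n,lin}(γ)`. -/
noncomputable def RLin (u : EuclideanSpace ℝ (Fin p)) (K : Bounds) (n : ℕ) (γ : ℝ) : ℝ :=
  √2 * ‖u‖ * K.lamReg ^ (-(1 / 2) : ℝ)
    * (gammaTilde K n γ / (1 - gammaTilde K n γ)) * (K.KEps / γ) ^ (1 / 4 : ℝ)

/-- The variance remainder `R_{n,var}(γ)`. -/
noncomputable def RVar (K : Bounds) (γ : ℝ) : ℝ :=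
  2 / (n * K.lamReg ^ 3) * (gammaTilde K n γ / (1 - gammaTilde K n γ) + 1) ^ 2
      * √(K.KEps / γ) * ((n : ℝ)⁻¹ * ∑ i, ‖(D i).1‖ ^ 4)
  + 2 * √2 / (K.lamReg ^ (5 / 2 : ℝ) * √(n : ℝ))
      * (gammaTilde K n γ / (1 - gammaTilde K n γ) + 1)
      * (K.KEps / γ) ^ (1 / 4 : ℝ) * ((n : ℝ)⁻¹ * ∑ i, ‖(D i).1‖ ^ 3 * |resid D i|)
  + K.KReg / (n * γ) / (K.lamReg ^ 2 * (1 - gammaTilde K n γ) ^ 2)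
      * ((n : ℝ)⁻¹ * ∑ i, ‖resid D i • (D i).1‖ ^ 2)
  + 2 * gammaTilde K n γ / (K.lamReg * (1 - gammaTilde K n γ))
      * specNorm ((n : ℝ)⁻¹ • ∑ i, resid D i ^ 2 • (outer (D i).1 * pinv (gram D)))

/-- The enlarged variance `u' V̂ u + ‖u‖² R_{n,var}(γ)`. -/
noncomputable def enlargedVar (u : EuclideanSpace ℝ (Fin p)) (K : Bounds) (γ : ℝ) : ℝ :=
  inner ℝ u (mulV (VHat D) u) + ‖u‖ ^ 2 * RVar D K γ

end Sample

/-! ### The confidence interval -/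

/-- The user-chosen sequences `δ_n`, `a_n`, `ω_n`. -/
structure Tuning where
  delta : ℕ → ℝ
  a : ℕ → ℝ
  omega : ℕ → ℝ

/-- `ν_n^Edg`. -/
noncomputable def nuEdg (α : ℝ) (K : Bounds) (t : Tuning) (n : ℕ) : ℝ :=
  (t.omega n * α + Real.exp (-(n * (1 - 1 / t.a n) ^ 2) / (2 * K.KXi))) / 2 + t.delta n

/-- The threshold `n₀`: the largest `n ≥ 1` with `n ≤ 2 K_reg / (ω_n α)` or `ν_n^Edg ≥ α / 2`;
it is `0` if there is no such `n`, and `∞` if there are arbitrarily large ones. -/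
noncomputable def n0 (α : ℝ) (K : Bounds) (t : Tuning) : ℕ∞ :=
  ⨆ m ∈ {m : ℕ | 1 ≤ m ∧ ((m : ℝ) ≤ 2 * K.KReg / (t.omega m * α) ∨ α / 2 ≤ nuEdg α K t m)},
    (m : ℕ∞)

/-- Half-width of the interval when `n > n₀`. With `D` the enlarged variance it equals
`Q_n / √n * √D`, where `Q_n = √a_n q(1 - α/2 + ν_n^Edg) + R_{n,lin} / √D`; the product is
written out, so that no division by `√D` occurs when `D = 0`. -/
noncomputable def halfWidth {p n : ℕ} (u : EuclideanSpace ℝ (Fin p)) (α : ℝ) (K : Bounds)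
    (t : Tuning) (D : Fin n → EuclideanSpace ℝ (Fin p) × ℝ) : ℝ :=
  (√(t.a n) * gaussQuantile (1 - α / 2 + nuEdg α K t n)
      * √(enlargedVar D u K (t.omega n * α / 2))
    + RLin u K n (t.omega n * α / 2)) / √(n : ℝ)

open Classical in
/-- The confidence interval `CI_u^Edg(1 - α, n)` computed from the sample `D`. -/
noncomputable def CIEdg {p n : ℕ} (u : EuclideanSpace ℝ (Fin p)) (α : ℝ) (K : Bounds)
    (t : Tuning) (D : Fin n → EuclideanSpace ℝ (Fin p) × ℝ) : Set ℝ :=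
  if (n : ℕ∞) ≤ n0 α K t then Set.univ
  else Set.Icc (inner ℝ u (betaHat D) - halfWidth u α K t D)
    (inner ℝ u (betaHat D) + halfWidth u α K t D)

/-- The set-valued statistic `CS` of `n` i.i.d. observations with law `P θ` is a valid confidence
set for `T θ` over `Θ` at the given level: the coverage event is measurable, and its probability
under the law of the sample is at least `level`. -/
def IsValidConfidenceSet {Par 𝒳 : Type*} [MeasurableSpace 𝒳] (P : Par → Measure 𝒳)
    (T : Par → ℝ) (Θ : Set Par) (level : ℝ) (n : ℕ) (CS : (Fin n → 𝒳) → Set ℝ) : Prop :=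
  ∀ θ ∈ Θ, MeasurableSet {D | T θ ∈ CS D} ∧
    level ≤ (Measure.pi fun _ : Fin n => P θ).real {D | T θ ∈ CS D}

end OLS

/-! ### Moments and tails of sums of independent variables -/

namespace OLS

section Moments

variable {Ω F : Type*} [MeasurableSpace Ω] {P : Measure Ω} [NormedAddCommGroup F]

/-! The interval can miss `u'β₀` only on four exceptional events whose probabilities, by the choice
of `ν_n`, add up to at most `α`. Put `Q = E[XX']`, `R = Q^{-1/2}`, `γ = ω_n α / 2`, `q` the normal
quantile of order `τ = 1 - α/2 + ν_n`, and `D` the enlarged variance. The events and their bounds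
are: (A) the rotated Gram matrix `RSR` is farther than `γ̃` from the identity: at most `γ`, by
Chebyshev for a centred i.i.d. average (`measureReal_gram_dev_le`); (B) the rotated score average is
larger than `√2 (K_ε/γ)^{1/4} / √n`: at most `γ`, by Markov with a fourth moment
(`measureReal_score_le`); (C) the average of `ξ_i²` is below `E[ξ²] / a_n`: an exponentially small
bound, by a Chernoff argument for nonnegative variables (`measureReal_sum_xi_sq_le`); (S) the
standardized sum of the `ξ_i` exceeds `q` in absolute value: at most `2(1 - τ) + 2δ_n`
(`measureReal_abs_sum_xi_gt_le`). The Edgeworth correction is even in `x`, so it cancels in a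
two-sided probability; this is why either distance to normality serves.

Off these events everything is deterministic. If `RSR` is close to the identity then `S` is
invertible and `S⁻¹ = R(1 + W)R` with `W` small, while `Q⁻¹ = RR`. Hence `u'β̂ - u'β₀` is the mean
of the `ξ_i` up to `R_{n,lin}/√n`, and the mean of the `ξ_i²` is at most `D` (`linearization`,
resting on `avg_inner_sq_le`). With (C) excluded, `E[ξ²] ≤ a_n D`; with (S) excluded, the mean of
the `ξ_i` is at most `q √(a_n D) / √n` in absolute value. Adding the two errors gives exactly the
half-width (`mem_CIEdg_of_good`).

Measurability of coverage reduces to that of the pseudo-inverse, which is discontinuous but has a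
closed graph (`measurable_pinv`). -/

theorem integrable_norm_pow_of_memLp [IsProbabilityMeasure P] {X : Ω → F} {k m : ℕ}
    (hk : k ≠ 0) (hkm : k ≤ m)
    (hX : MemLp X m P) : Integrable (fun ω => ‖X ω‖ ^ k) P :=
  (hX.mono_exponent (by exact_mod_cast hkm)).integrable_norm_pow hk

variable [InnerProductSpace ℝ F]

/-- Square `‖s‖² + 2⟨s,z⟩ + ‖z‖²` and bound `4⟨s,z⟩²` by Cauchy–Schwarz, whence `6 = 2 + 4`. The odd
terms are kept as inner products linear in `z` or in `s`, so that they vanish in expectation for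
independent centred vectors. -/
theorem norm_add_pow_four_le (s z : F) :
    ‖s + z‖ ^ 4 ≤ ‖s‖ ^ 4 + ‖z‖ ^ 4 + 6 * (‖s‖ ^ 2 * ‖z‖ ^ 2)
      + 4 * inner ℝ (‖s‖ ^ 2 • s) z + 4 * inner ℝ s (‖z‖ ^ 2 • z) := by
  have h : ‖s + z‖ ^ 4 = (‖s‖ ^ 2 + 2 * inner ℝ s z + ‖z‖ ^ 2) ^ 2 := by
    rw [← norm_add_sq_real]; ring
  have h1 : (inner ℝ s z : ℝ) ^ 2 ≤ ‖s‖ ^ 2 * ‖z‖ ^ 2 := by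
    rw [← mul_pow, sq_le_sq, abs_of_nonneg (by positivity : 0 ≤ ‖s‖ * ‖z‖)]
    exact abs_real_inner_le_norm s z
  rw [h, real_inner_smul_left, real_inner_smul_right]
  nlinarith

theorem integrable_norm_sq_smul_of_memLp [IsProbabilityMeasure P] {X : Ω → F} (hX : MemLp X 4 P) :
    Integrable (fun ω => ‖X ω‖ ^ 2 • X ω) P := by
  refine (integrable_norm_pow_of_memLp (k := 3) (m := 4) (by norm_num) (by norm_num) hX).mono'
    ((hX.1.norm.pow 2).smul hX.1) (ae_of_all _ fun ω => ?_)
  rw [norm_smul, norm_pow, norm_norm]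
  exact le_of_eq (by ring)

variable [MeasurableSpace F] [BorelSpace F]

theorem integrable_inner_of_indepFun {X Y : Ω → F} (h : X ⟂ᵢ[P] Y) (hX : Integrable X P)
    (hY : Integrable Y P) : Integrable (fun ω => (inner ℝ (X ω) (Y ω) : ℝ)) P :=
  h.integrable_bilin hX hY (innerSL ℝ)

variable [CompleteSpace F]

theorem integral_inner_eq_zero_of_indepFun {X Y : Ω → F} (h : X ⟂ᵢ[P] Y) (hX : Integrable X P)
    (hY : Integrable Y P) (h0 : P[X] = 0 ∨ P[Y] = 0) : ∫ ω, inner ℝ (X ω) (Y ω) ∂P = 0 := by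
  refine (h.integral_bilin hX hY (innerSL ℝ)).trans ?_
  rcases h0 with h0 | h0 <;> simp [h0]

variable [IsProbabilityMeasure P] [SecondCountableTopology F] {ι : Type*} {Z : ι → Ω → F}

theorem integral_norm_sum_sq_of_iIndepFun (hZ : iIndepFun Z P) (hm : ∀ i, Measurable (Z i))
    (hL : ∀ i, MemLp (Z i) 2 P) (h0 : ∀ i, P[Z i] = 0) {m₂ : ℝ}
    (h2 : ∀ i, ∫ ω, ‖Z i ω‖ ^ 2 ∂P ≤ m₂) (s : Finset ι) :
    ∫ ω, ‖(∑ i ∈ s, Z i) ω‖ ^ 2 ∂P ≤ s.card * m₂ := by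
  classical
  induction s using Finset.induction_on with
  | empty => simp
  | insert a s ha ih =>
    have hind := hZ.indepFun_finsetSum_of_notMem hm ha
    have hS : MemLp (∑ i ∈ s, Z i) 2 P := memLp_finsetSum' s fun i _ => hL i
    have hSi := hS.integrable one_le_two
    have hZi := (hL a).integrable one_le_two
    have i1 := integrable_norm_pow_of_memLp (k := 2) (m := 2) (by norm_num) le_rfl hS
    have i2 := integrable_norm_pow_of_memLp (k := 2) (m := 2) (by norm_num) le_rfl (hL a)
    have i3 := (integrable_inner_of_indepFun hind hSi hZi).const_mul 2
    have e3 := integral_inner_eq_zero_of_indepFun hind hSi hZi (Or.inr (h0 a))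
    have : ∀ ω, ‖(∑ i ∈ insert a s, Z i) ω‖ ^ 2
        = ‖(∑ i ∈ s, Z i) ω‖ ^ 2 + 2 * inner ℝ ((∑ i ∈ s, Z i) ω) (Z a ω) + ‖Z a ω‖ ^ 2 := by
      intro ω
      rw [Finset.sum_insert ha, add_comm, Pi.add_apply, norm_add_sq_real]
    simp_rw [this]
    have i13 : Integrable (fun ω => ‖(∑ i ∈ s, Z i) ω‖ ^ 2
        + 2 * inner ℝ ((∑ i ∈ s, Z i) ω) (Z a ω)) P := i1.add i3
    rw [integral_add i13 i2, integral_add i1 i3, integral_const_mul, e3,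
      Finset.card_insert_of_notMem ha]
    push_cast
    linarith [h2 a]

/-- Adding one variable to `k` others costs at most `m₄ + 6 k m₄`, and `3k² + 6k + 1 ≤ 3(k + 1)²`.
-/
theorem integral_norm_sum_pow_four_of_iIndepFun (hZ : iIndepFun Z P)
    (hm : ∀ i, Measurable (Z i)) (hL : ∀ i, MemLp (Z i) 4 P) (h0 : ∀ i, P[Z i] = 0) {m₄ : ℝ}
    (h4 : ∀ i, ∫ ω, ‖Z i ω‖ ^ 4 ∂P ≤ m₄) (s : Finset ι) :
    ∫ ω, ‖(∑ i ∈ s, Z i) ω‖ ^ 4 ∂P ≤ 3 * s.card ^ 2 * m₄ := by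
  classical
  induction s using Finset.induction_on with
  | empty => simp
  | insert a s ha ih =>
    have hm4 : 0 ≤ m₄ := (integral_nonneg fun ω => by positivity).trans (h4 a)
    have hind := hZ.indepFun_finsetSum_of_notMem hm ha
    have hS : MemLp (∑ i ∈ s, Z i) 4 P := memLp_finsetSum' s fun i _ => hL i
    have h14 : (1 : ENNReal) ≤ 4 := by norm_num
    have hSi := hS.integrable h14
    have hZi := (hL a).integrable h14
    have hL2 : ∀ i, MemLp (Z i) 2 P := fun i => (hL i).mono_exponent (by norm_num)
    have hsm : Measurable fun v : F => ‖v‖ ^ 2 • v := by fun_prop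
    have i1 := integrable_norm_pow_of_memLp (k := 4) (m := 4) (by norm_num) le_rfl hS
    have i2 := integrable_norm_pow_of_memLp (k := 4) (m := 4) (by norm_num) le_rfl (hL a)
    have j1 := integrable_norm_pow_of_memLp (k := 2) (m := 4) (by norm_num) (by norm_num) hS
    have j2 := integrable_norm_pow_of_memLp (k := 2) (m := 4) (by norm_num) (by norm_num) (hL a)
    have hindn : (fun ω => ‖(∑ i ∈ s, Z i) ω‖ ^ 2) ⟂ᵢ[P] (fun ω => ‖Z a ω‖ ^ 2) :=
      hind.comp (φ := fun v : F => ‖v‖ ^ 2) (ψ := fun v : F => ‖v‖ ^ 2) (by fun_prop) (by fun_prop)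
    have hind1 : (fun ω => ‖(∑ i ∈ s, Z i) ω‖ ^ 2 • (∑ i ∈ s, Z i) ω) ⟂ᵢ[P] Z a :=
      hind.comp (φ := fun v : F => ‖v‖ ^ 2 • v) (ψ := id) hsm measurable_id
    have hind2 : (∑ i ∈ s, Z i) ⟂ᵢ[P] (fun ω => ‖Z a ω‖ ^ 2 • Z a ω) :=
      hind.comp (φ := id) (ψ := fun v : F => ‖v‖ ^ 2 • v) measurable_id hsm
    have i3 : Integrable (fun ω => ‖(∑ i ∈ s, Z i) ω‖ ^ 2 * ‖Z a ω‖ ^ 2) P :=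
      hindn.integrable_mul j1 j2
    have e3 : ∫ ω, ‖(∑ i ∈ s, Z i) ω‖ ^ 2 * ‖Z a ω‖ ^ 2 ∂P
        = (∫ ω, ‖(∑ i ∈ s, Z i) ω‖ ^ 2 ∂P) * ∫ ω, ‖Z a ω‖ ^ 2 ∂P :=
      hindn.integral_fun_mul_eq_mul_integral j1.1 j2.1
    have i4 := integrable_inner_of_indepFun hind1 (integrable_norm_sq_smul_of_memLp hS) hZi
    have e4 := integral_inner_eq_zero_of_indepFun hind1 (integrable_norm_sq_smul_of_memLp hS) hZi
      (Or.inr (h0 a))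
    have hS0 : P[∑ i ∈ s, Z i] = 0 := by
      simp_rw [Finset.sum_apply]
      rw [integral_finsetSum s fun i _ => (hL i).integrable h14]
      exact Finset.sum_eq_zero fun i _ => h0 i
    have i5 := integrable_inner_of_indepFun hind2 hSi (integrable_norm_sq_smul_of_memLp (hL a))
    have e5 := integral_inner_eq_zero_of_indepFun hind2 hSi
      (integrable_norm_sq_smul_of_memLp (hL a))
      (Or.inl hS0)
    -- Jensen, obtained by expanding `E(‖Z‖² - c)² ≥ 0` at `c = E‖Z‖²`.
    have hsq : ∀ i, ∫ ω, ‖Z i ω‖ ^ 2 ∂P ≤ √m₄ := by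
      intro i
      refine Real.le_sqrt_of_sq_le (le_trans ?_ (h4 i))
      have hi2 := integrable_norm_pow_of_memLp (k := 2) (m := 4) (by norm_num) (by norm_num) (hL i)
      have hi4 := integrable_norm_pow_of_memLp (k := 4) (m := 4) (by norm_num) le_rfl (hL i)
      set c := ∫ ω, ‖Z i ω‖ ^ 2 ∂P
      have hp : 0 ≤ ∫ ω, (‖Z i ω‖ ^ 4 - 2 * c * ‖Z i ω‖ ^ 2 + c ^ 2) ∂P :=
        integral_nonneg fun ω => by
          have : 0 ≤ (‖Z i ω‖ ^ 2 - c) ^ 2 := sq_nonneg _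
          simp only [Pi.zero_apply]
          linarith
      have hi : Integrable (fun ω => ‖Z i ω‖ ^ 4 - 2 * c * ‖Z i ω‖ ^ 2) P :=
        hi4.sub (hi2.const_mul _)
      rw [integral_add hi (integrable_const _),
        integral_sub hi4 (hi2.const_mul _), integral_const_mul] at hp
      simp only [integral_const, probReal_univ, one_smul] at hp
      change 0 ≤ _ - 2 * c * c + _ at hp
      linarith
    have hs2 := integral_norm_sum_sq_of_iIndepFun hZ hm hL2 h0 hsq s
    have hmul : (∫ ω, ‖(∑ i ∈ s, Z i) ω‖ ^ 2 ∂P) * ∫ ω, ‖Z a ω‖ ^ 2 ∂P ≤ s.card * m₄ := by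
      calc _ ≤ (s.card * √m₄) * √m₄ :=
            mul_le_mul hs2 (hsq a) (integral_nonneg fun ω => by positivity) (by positivity)
        _ = s.card * m₄ := by rw [mul_assoc, Real.mul_self_sqrt hm4]
    have hI := ((((i1.add i2).add (i3.const_mul 6)).add (i4.const_mul 4)).add (i5.const_mul 4))
    refine (integral_mono_of_nonneg (ae_of_all _ fun ω => by positivity) hI
      (ae_of_all _ fun ω => ?_)).trans ?_
    · rw [Finset.sum_insert ha, add_comm, Pi.add_apply]
      exact norm_add_pow_four_le _ _
    rw [integral_add' (((i1.add i2).add (i3.const_mul 6)).add (i4.const_mul 4)) (i5.const_mul 4),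
      integral_add' ((i1.add i2).add (i3.const_mul 6)) (i4.const_mul 4),
      integral_add' (i1.add i2) (i3.const_mul 6), integral_add' i1 i2,
      integral_const_mul, integral_const_mul, integral_const_mul, e3, e4, e5,
      Finset.card_insert_of_notMem ha]
    push_cast
    nlinarith [h4 a]

end Moments

/-! ### Lower tails of sums of nonnegative variables. -/

/-- `(1 + x + x²/2)(1 - x + x²/2) = 1 + x⁴/4 ≥ 1`, and the first factor is at most `exp x`. As it
holds on the whole half-line, two moments suffice to control the Laplace transform of a nonnegative
variable. -/
theorem exp_neg_le_one_sub_add_sq {x : ℝ} (hx : 0 ≤ x) : Real.exp (-x) ≤ 1 - x + x ^ 2 / 2 := by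
  have h := Real.quadratic_le_exp_of_nonneg hx
  rw [Real.exp_neg, inv_le_iff_one_le_mul₀ (Real.exp_pos x)]
  have h1 : 0 ≤ 1 - x + x ^ 2 / 2 := by nlinarith [sq_nonneg (x - 1)]
  nlinarith [mul_le_mul_of_nonneg_left h h1, sq_nonneg (x ^ 2)]

/-- One-sided exponential inequality for the lower tail of a sum of nonnegative variables. -/
theorem measureReal_sum_le_of_nonneg {Ω ι : Type*} [MeasurableSpace Ω] {P : Measure Ω}
    [IsProbabilityMeasure P] [Fintype ι] {Y : ι → Ω → ℝ} (hY : iIndepFun Y P)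
    (hm : ∀ i, Measurable (Y i)) (hnn : ∀ i ω, 0 ≤ Y i ω) (h1 : ∀ i, Integrable (Y i) P)
    (h2 : ∀ i, Integrable (fun ω => Y i ω ^ 2) P) {μ m t : ℝ} (hμ : ∀ i, P[Y i] = μ)
    (hm2 : ∀ i, ∫ ω, Y i ω ^ 2 ∂P ≤ m) (hm0 : 0 < m) (ht : 0 ≤ t) :
    P.real {ω | ∑ i, Y i ω ≤ Fintype.card ι * (μ - t)}
      ≤ Real.exp (-(Fintype.card ι * t ^ 2 / (2 * m))) := by
  -- The minimizer of the Chernoff exponent `-s t + s² m / 2`.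
  set s := t / m with hs
  have hs0 : 0 ≤ s := by positivity
  have hmgf : ∀ i, mgf (Y i) P (-s) ≤ Real.exp (-s * μ + s ^ 2 * m / 2) := by
    intro i
    refine le_trans ?_ (Real.add_one_le_exp _)
    have : mgf (Y i) P (-s) ≤ ∫ ω, (1 - s * Y i ω + s ^ 2 / 2 * Y i ω ^ 2) ∂P := by
      refine integral_mono_of_nonneg (ae_of_all _ fun ω => (Real.exp_pos _).le)
        (((integrable_const _).sub ((h1 i).const_mul _)).add ((h2 i).const_mul _))
        (ae_of_all _ fun ω => ?_)
      have := exp_neg_le_one_sub_add_sq (mul_nonneg hs0 (hnn i ω))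
      rw [← neg_mul] at this
      exact this.trans (le_of_eq (by ring))
    refine this.trans ?_
    have hi : Integrable (fun ω => 1 - s * Y i ω) P :=
      (integrable_const _).sub ((h1 i).const_mul _)
    rw [integral_add hi ((h2 i).const_mul _),
      integral_sub (integrable_const _) ((h1 i).const_mul _), integral_const_mul,
      integral_const_mul, hμ i]
    simp only [integral_const, probReal_univ, one_smul]
    nlinarith [mul_le_mul_of_nonneg_left (hm2 i) (by positivity : 0 ≤ s ^ 2 / 2)]
  have hint : Integrable (fun ω => Real.exp (-s * (∑ i, Y i) ω)) P := by
    refine Integrable.of_bound (C := 1) ?_ (ae_of_all _ fun ω => ?_)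
    · simp only [Finset.sum_apply]
      fun_prop
    · rw [Real.norm_eq_abs, Real.abs_exp, Real.exp_le_one_iff, Finset.sum_apply]
      have := mul_nonneg hs0 (Finset.sum_nonneg fun i (_ : i ∈ Finset.univ) => hnn i ω)
      linarith
  have hch := measure_le_le_exp_mul_mgf (X := ∑ i, Y i) (μ := P) (t := -s)
    (Fintype.card ι * (μ - t)) (by linarith) hint
  rw [hY.mgf_sum hm] at hch
  simp only [Finset.sum_apply] at hch
  refine hch.trans ?_
  have hprod : ∏ i, mgf (Y i) P (-s) ≤ Real.exp (-s * μ + s ^ 2 * m / 2) ^ Fintype.card ι := by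
    rw [← Finset.card_univ, ← Finset.prod_const]
    exact Finset.prod_le_prod (fun i _ => mgf_nonneg) fun i _ => hmgf i
  refine (mul_le_mul_of_nonneg_left hprod (Real.exp_pos _).le).trans (le_of_eq ?_)
  rw [← Real.exp_nat_mul, ← Real.exp_add]
  congr 1
  rw [hs]
  field_simp
  ring

/-! ### Matrices acting on Euclidean space -/

section LinearAlgebra

variable {p : ℕ}

theorem mulV_eq_toEuclideanCLM (A : Matrix (Fin p) (Fin p) ℝ) (x : EuclideanSpace ℝ (Fin p)) :
    mulV A x = Matrix.toEuclideanCLM (n := Fin p) (𝕜 := ℝ) A x := rfl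

theorem mulV_mul (A B : Matrix (Fin p) (Fin p) ℝ) (x : EuclideanSpace ℝ (Fin p)) :
    mulV (A * B) x = mulV A (mulV B x) := by
  simp [mulV_eq_toEuclideanCLM]

theorem mulV_add (A : Matrix (Fin p) (Fin p) ℝ) (x y : EuclideanSpace ℝ (Fin p)) :
    mulV A (x + y) = mulV A x + mulV A y := by
  simp [mulV_eq_toEuclideanCLM]

theorem mulV_smul (A : Matrix (Fin p) (Fin p) ℝ) (c : ℝ) (x : EuclideanSpace ℝ (Fin p)) :
    mulV A (c • x) = c • mulV A x := by
  simp [mulV_eq_toEuclideanCLM]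

theorem mulV_sum {ι : Type*} (s : Finset ι) (A : Matrix (Fin p) (Fin p) ℝ)
    (x : ι → EuclideanSpace ℝ (Fin p)) : mulV A (∑ i ∈ s, x i) = ∑ i ∈ s, mulV A (x i) := by
  simp [mulV_eq_toEuclideanCLM]

theorem add_mulV (A B : Matrix (Fin p) (Fin p) ℝ) (x : EuclideanSpace ℝ (Fin p)) :
    mulV (A + B) x = mulV A x + mulV B x := by
  simp [mulV_eq_toEuclideanCLM]

theorem sub_mulV (A B : Matrix (Fin p) (Fin p) ℝ) (x : EuclideanSpace ℝ (Fin p)) :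
    mulV (A - B) x = mulV A x - mulV B x := by
  simp [mulV_eq_toEuclideanCLM]

theorem smul_mulV (c : ℝ) (A : Matrix (Fin p) (Fin p) ℝ) (x : EuclideanSpace ℝ (Fin p)) :
    mulV (c • A) x = c • mulV A x := by
  simp [mulV_eq_toEuclideanCLM]

theorem sum_mulV {ι : Type*} (s : Finset ι) (A : ι → Matrix (Fin p) (Fin p) ℝ)
    (x : EuclideanSpace ℝ (Fin p)) : mulV (∑ i ∈ s, A i) x = ∑ i ∈ s, mulV (A i) x := by
  simp [mulV_eq_toEuclideanCLM]

theorem one_mulV (x : EuclideanSpace ℝ (Fin p)) : mulV 1 x = x := by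
  simp [mulV_eq_toEuclideanCLM]

theorem mulV_outer (x v : EuclideanSpace ℝ (Fin p)) : mulV (outer x) v = (inner ℝ x v : ℝ) • x := by
  ext i
  simp only [mulV, outer, Matrix.mulVec, dotProduct, Matrix.of_apply, PiLp.inner_apply,
    RCLike.inner_apply, conj_trivial, PiLp.smul_apply, smul_eq_mul, Finset.sum_mul]
  exact Finset.sum_congr rfl fun j _ => by ring

theorem inner_mulV_left (A : Matrix (Fin p) (Fin p) ℝ) (x y : EuclideanSpace ℝ (Fin p)) :
    inner ℝ (mulV A x) y = (inner ℝ x (mulV Aᵀ y) : ℝ) := by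
  simp only [mulV, EuclideanSpace.inner_eq_star_dotProduct, star_trivial]
  rw [Matrix.mulVec_transpose, Matrix.dotProduct_mulVec]

theorem inner_mulV_of_symm {A : Matrix (Fin p) (Fin p) ℝ} (hA : Aᵀ = A)
    (x y : EuclideanSpace ℝ (Fin p)) : inner ℝ (mulV A x) y = (inner ℝ x (mulV A y) : ℝ) := by
  rw [inner_mulV_left, hA]

theorem norm_mulV_le_specNorm (A : Matrix (Fin p) (Fin p) ℝ) (x : EuclideanSpace ℝ (Fin p)) :
    ‖mulV A x‖ ≤ specNorm A * ‖x‖ :=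
  (Matrix.toEuclideanCLM (n := Fin p) (𝕜 := ℝ) A).le_opNorm x

theorem norm_toLp_vec_sq (M : Matrix (Fin p) (Fin p) ℝ) :
    ‖WithLp.toLp 2 M.vec‖ ^ 2 = ∑ i, ∑ j, M i j ^ 2 := by
  rw [EuclideanSpace.real_norm_sq_eq, Fintype.sum_prod_type, Finset.sum_comm]
  rfl

theorem norm_mulV_le_vec (M : Matrix (Fin p) (Fin p) ℝ) (v : EuclideanSpace ℝ (Fin p)) :
    ‖mulV M v‖ ≤ ‖WithLp.toLp 2 M.vec‖ * ‖v‖ := by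
  refine (sq_le_sq₀ (norm_nonneg _) (by positivity)).1 ?_
  rw [mul_pow, norm_toLp_vec_sq, EuclideanSpace.real_norm_sq_eq, EuclideanSpace.real_norm_sq_eq,
    Finset.sum_mul]
  refine Finset.sum_le_sum fun i _ => ?_
  exact Finset.sum_mul_sq_le_sq_mul_sq Finset.univ (M i) v.ofLp

theorem outer_transpose (x : EuclideanSpace ℝ (Fin p)) : (outer x)ᵀ = outer x := by
  ext i j
  simp [outer, mul_comm]

theorem outer_mulV (A : Matrix (Fin p) (Fin p) ℝ) (x : EuclideanSpace ℝ (Fin p)) :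
    outer (mulV A x) = A * outer x * Aᵀ := by
  ext i j
  simp only [outer, mulV, Matrix.mulVec, dotProduct, Matrix.mul_apply, Matrix.of_apply,
    Matrix.transpose_apply, Finset.sum_mul]
  rw [Finset.sum_comm]
  refine Finset.sum_congr rfl fun k _ => ?_
  rw [Finset.mul_sum]
  exact Finset.sum_congr rfl fun l _ => by ring

theorem isHermitian_of_transpose {A : Matrix (Fin p) (Fin p) ℝ} (hA : Aᵀ = A) : A.IsHermitian := by
  rwa [Matrix.IsHermitian, Matrix.conjTranspose_eq_transpose_of_trivial]

theorem lamMin_le_of_mem_spectrum {A : Matrix (Fin p) (Fin p) ℝ} {x : ℝ}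
    (hx : x ∈ spectrum ℝ A) : lamMin A ≤ x :=
  csInf_le (Matrix.finite_real_spectrum (A := A)).bddBelow hx

/-- Subtracting `lamMin A` times the identity leaves a symmetric matrix with nonnegative spectrum.
-/
theorem lamMin_mul_le_inner {A : Matrix (Fin p) (Fin p) ℝ} (hA : Aᵀ = A)
    (v : EuclideanSpace ℝ (Fin p)) : lamMin A * ‖v‖ ^ 2 ≤ inner ℝ v (mulV A v) := by
  have h : (A - algebraMap ℝ _ (lamMin A)).PosSemidef := by
    rw [Matrix.posSemidef_iff_isHermitian_and_spectrum_nonneg]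
    refine ⟨isHermitian_of_transpose ?_, ?_⟩
    · rw [Matrix.transpose_sub, hA, Algebra.algebraMap_eq_smul_one, Matrix.transpose_smul,
        Matrix.transpose_one]
    · rw [← spectrum.sub_singleton_eq]
      rintro _ ⟨x, hx, _, rfl, rfl⟩
      exact sub_nonneg.2 (lamMin_le_of_mem_spectrum hx)
  have h2 := h.dotProduct_mulVec_nonneg v.ofLp
  have h3 : (inner ℝ v (mulV (A - algebraMap ℝ _ (lamMin A)) v) : ℝ)
      = star v.ofLp ⬝ᵥ (A - algebraMap ℝ _ (lamMin A)) *ᵥ v.ofLp := by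
    rw [EuclideanSpace.inner_eq_star_dotProduct, star_trivial, dotProduct_comm]
    rfl
  rw [← h3, sub_mulV, Algebra.algebraMap_eq_smul_one, smul_mulV, one_mulV, inner_sub_right,
    real_inner_smul_right, real_inner_self_eq_norm_sq] at h2
  linarith

theorem invSqrt_transpose (A : Matrix (Fin p) (Fin p) ℝ) : (invSqrt A)ᵀ = invSqrt A := by
  have h : IsSelfAdjoint (invSqrt A) := cfc_predicate _ A
  simpa [Matrix.star_eq_conjTranspose, Matrix.conjTranspose_eq_transpose_of_trivial] using h.star_eq

theorem invSqrt_mul_mul_invSqrt {A : Matrix (Fin p) (Fin p) ℝ} (hA : Aᵀ = A)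
    (hpos : 0 < lamMin A) : invSqrt A * A * invSqrt A = 1 := by
  have hs : IsSelfAdjoint A := (isHermitian_of_transpose hA).isSelfAdjoint
  have hc : ∀ f : ℝ → ℝ, ContinuousOn f (spectrum ℝ A) := fun f =>
    (Matrix.finite_real_spectrum (A := A)).continuousOn f
  have hid : cfc (fun x : ℝ => x) A = A := cfc_id' ℝ A
  have h1 : invSqrt A * A = cfc (fun x : ℝ => (√x)⁻¹ * x) A := by
    rw [cfc_mul (fun x : ℝ => (√x)⁻¹) (fun x : ℝ => x) A (hc _) (hc _), hid, invSqrt]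
  rw [h1, invSqrt, ← cfc_mul _ _ A (hc _) (hc _), ← cfc_one ℝ A]
  refine cfc_congr fun x hx => ?_
  have hx0 : 0 < x := hpos.trans_le (lamMin_le_of_mem_spectrum hx)
  have h2 : √x ≠ 0 := (Real.sqrt_pos.2 hx0).ne'
  have h3 : √x * √x = x := Real.mul_self_sqrt hx0.le
  simp only [Pi.one_apply]
  field_simp
  nlinarith

theorem inv_eq_mul_of_mul_mul_eq_one {Q R : Matrix (Fin p) (Fin p) ℝ} (h : R * Q * R = 1) :
    Q⁻¹ = R * R := by
  refine Matrix.inv_eq_right_inv ?_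
  have h1 : R * (Q * R) = 1 := by rw [← Matrix.mul_assoc, h]
  have h2 : Q * R * R = 1 := mul_eq_one_comm.1 h1
  rw [← Matrix.mul_assoc, h2]

theorem rpow_neg_half_sq {c : ℝ} (hc : 0 < c) : (c ^ (-(1 / 2) : ℝ)) ^ 2 = c⁻¹ := by
  rw [← Real.rpow_natCast, ← Real.rpow_mul hc.le, ← Real.rpow_neg_one]
  norm_num

/-- Test the lower bound for `Q` on the vector `Rv`: the quadratic form becomes `⟨v, RQRv⟩ = ‖v‖²`.
-/
theorem norm_mulV_le_of_mul_mul_eq_one {Q R : Matrix (Fin p) (Fin p) ℝ} {c : ℝ} (hc : 0 < c)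
    (hR : Rᵀ = R) (h : R * Q * R = 1)
    (hQ : ∀ v : EuclideanSpace ℝ (Fin p), c * ‖v‖ ^ 2 ≤ inner ℝ v (mulV Q v))
    (v : EuclideanSpace ℝ (Fin p)) : ‖mulV R v‖ ≤ c ^ (-(1 / 2) : ℝ) * ‖v‖ := by
  have h1 := hQ (mulV R v)
  rw [inner_mulV_of_symm hR, ← mulV_mul, ← mulV_mul, h, one_mulV,
    real_inner_self_eq_norm_sq] at h1
  refine (sq_le_sq₀ (norm_nonneg _) (by positivity)).1 ?_
  rw [mul_pow, rpow_neg_half_sq hc, inv_mul_eq_div, le_div_iff₀ hc]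
  linarith

theorem pinv_eq_inv {A : Matrix (Fin p) (Fin p) ℝ} (hA : IsUnit A.det) : pinv A = A⁻¹ := by
  refine (pinv_isMoorePenrose A).unique ⟨?_, ?_, ?_, ?_⟩ <;>
    simp [Matrix.mul_nonsing_inv A hA, Matrix.nonsing_inv_mul A hA]

/-- A matrix `1 + T` with `‖T‖ ≤ g < 1` is invertible, and its inverse is within `g / (1 - g)` of
the identity. -/
theorem exists_inverse_one_add {T : Matrix (Fin p) (Fin p) ℝ} {g : ℝ} (hg0 : 0 ≤ g) (hg : g < 1)
    (hT : ∀ v, ‖mulV T v‖ ≤ g * ‖v‖) :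
    ∃ W : Matrix (Fin p) (Fin p) ℝ, (1 + T) * (1 + W) = 1 ∧
      ∀ v, ‖mulV W v‖ ≤ g / (1 - g) * ‖v‖ := by
  have hinj : Function.Injective ((1 + T) *ᵥ ·) := by
    rw [← Matrix.coe_mulVecLin, ← LinearMap.ker_eq_bot, LinearMap.ker_eq_bot']
    intro v hv
    have h1 : mulV (1 + T) (WithLp.toLp 2 v) = 0 := by
      simp only [mulV]
      rw [show (1 + T) *ᵥ v = 0 from hv]
      rfl
    rw [add_mulV, one_mulV, add_eq_zero_iff_eq_neg] at h1
    have h2 := hT (WithLp.toLp 2 v)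
    have h3 : ‖WithLp.toLp 2 v‖ = ‖mulV T (WithLp.toLp 2 v)‖ := by
      conv_lhs => rw [h1, norm_neg]
    have h4 : ‖WithLp.toLp 2 v‖ = 0 := by
      nlinarith [norm_nonneg (WithLp.toLp 2 v)]
    simpa using h4
  have hu : IsUnit (1 + T) := Matrix.mulVec_injective_iff_isUnit.1 hinj
  have hmul : (1 + T) * (1 + T)⁻¹ = 1 :=
    Matrix.mul_nonsing_inv _ ((Matrix.isUnit_iff_isUnit_det _).1 hu)
  refine ⟨(1 + T)⁻¹ - 1, by rw [add_sub_cancel, hmul], fun v => ?_⟩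
  -- From `y + Ty = v` come both `((1 + T)⁻¹ - 1)v = -Ty` and `‖y‖ ≤ ‖v‖ / (1 - g)`.
  set y := mulV (1 + T)⁻¹ v with hy
  have h1 : y + mulV T y = v := by
    calc y + mulV T y = mulV (1 + T) y := by rw [add_mulV, one_mulV]
      _ = v := by rw [hy, ← mulV_mul, hmul, one_mulV]
  have h2 : mulV ((1 + T)⁻¹ - 1) v = -mulV T y := by
    rw [sub_mulV, one_mulV, ← hy, ← h1]
    abel
  have h3 := hT y
  have h4 : ‖y‖ ≤ ‖v‖ + g * ‖y‖ := by
    calc ‖y‖ = ‖v - mulV T y‖ := by rw [← h1]; abel_nf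
      _ ≤ ‖v‖ + ‖mulV T y‖ := norm_sub_le _ _
      _ ≤ _ := by gcongr
  have h5 : ‖y‖ ≤ ‖v‖ / (1 - g) := by
    rw [le_div_iff₀ (by linarith)]
    linarith
  rw [h2, norm_neg]
  calc ‖mulV T y‖ ≤ g * ‖y‖ := h3
    _ ≤ g * (‖v‖ / (1 - g)) := by gcongr
    _ = _ := by ring

theorem continuous_specNorm : Continuous (specNorm (p := p)) := by
  have h : Continuous (Matrix.toEuclideanCLM (n := Fin p) (𝕜 := ℝ)) :=
    LinearMap.continuous_of_finiteDimensional
      (Matrix.toEuclideanCLM (n := Fin p) (𝕜 := ℝ)).toAlgEquiv.toLinearEquiv.toLinearMap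
  exact h.norm

end LinearAlgebra

/-! ### Measurability of the pseudo-inverse -/

section Measurability

variable {p : ℕ}

instance : MeasurableSpace (Matrix (Fin p) (Fin p) ℝ) :=
  inferInstanceAs (MeasurableSpace (Fin p → Fin p → ℝ))

instance : BorelSpace (Matrix (Fin p) (Fin p) ℝ) :=
  inferInstanceAs (BorelSpace (Fin p → Fin p → ℝ))

instance : SecondCountableTopology (Matrix (Fin p) (Fin p) ℝ) :=
  inferInstanceAs (SecondCountableTopology (Fin p → Fin p → ℝ))

instance : PolishSpace (Matrix (Fin p) (Fin p) ℝ) :=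
  inferInstanceAs (PolishSpace (Fin p → Fin p → ℝ))

theorem isClosed_isMoorePenrose :
    IsClosed {q : Matrix (Fin p) (Fin p) ℝ × Matrix (Fin p) (Fin p) ℝ |
      IsMoorePenrose q.1 q.2} := by
  have : {q : Matrix (Fin p) (Fin p) ℝ × Matrix (Fin p) (Fin p) ℝ | IsMoorePenrose q.1 q.2}
      = {q | q.1 * q.2 * q.1 = q.1} ∩ {q | q.2 * q.1 * q.2 = q.2}
        ∩ {q | (q.1 * q.2)ᵀ = q.1 * q.2} ∩ {q | (q.2 * q.1)ᵀ = q.2 * q.1} := by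
    ext q
    exact ⟨fun h => ⟨⟨⟨h.1, h.2⟩, h.3⟩, h.4⟩, fun h => ⟨h.1.1.1, h.1.1.2, h.1.2, h.2⟩⟩
  rw [this]
  refine (((isClosed_eq ?_ ?_).inter (isClosed_eq ?_ ?_)).inter (isClosed_eq ?_ ?_)).inter
    (isClosed_eq ?_ ?_) <;> fun_prop

/-- The preimage of `s` is the first projection of a Borel part of the closed set of Penrose pairs.
Uniqueness of the pseudo-inverse makes that projection injective, so the image is Borel by
Lusin–Souslin. -/
theorem measurable_pinv : Measurable (pinv (p := p)) := by
  intro s hs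
  have h : pinv ⁻¹' s = Prod.fst ''
      ({q : Matrix (Fin p) (Fin p) ℝ × Matrix (Fin p) (Fin p) ℝ | IsMoorePenrose q.1 q.2}
        ∩ Prod.snd ⁻¹' s) := by
    ext A
    constructor
    · exact fun hA => ⟨(A, pinv A), ⟨pinv_isMoorePenrose A, hA⟩, rfl⟩
    · rintro ⟨⟨A', B⟩, ⟨hq, hB⟩, rfl⟩
      change pinv A' ∈ s
      rw [(pinv_isMoorePenrose A').unique hq]
      exact hB
  rw [h]
  refine MeasurableSet.image_of_measurable_injOn
    (isClosed_isMoorePenrose.measurableSet.inter (measurable_snd hs)) measurable_fst ?_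
  rintro ⟨A, B⟩ ⟨hB, -⟩ ⟨A', C⟩ ⟨hC, -⟩ (rfl : A = A')
  exact Prod.ext rfl (hB.unique hC)

end Measurability

/-! ### Deterministic bounds on the sample -/

section Deterministic

variable {p n : ℕ}

theorem gram_transpose (D : Fin n → EuclideanSpace ℝ (Fin p) × ℝ) : (gram D)ᵀ = gram D := by
  simp [gram, Matrix.transpose_sum, outer_transpose]

theorem mulV_gram (D : Fin n → EuclideanSpace ℝ (Fin p) × ℝ) (v : EuclideanSpace ℝ (Fin p)) :
    mulV (gram D) v = (n : ℝ)⁻¹ • ∑ i, (inner ℝ (D i).1 v : ℝ) • (D i).1 := by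
  simp [gram, smul_mulV, sum_mulV, mulV_outer]

/-- The observations `(X, X'β + ε)` as a function of `(X, ε)`. -/
noncomputable def observe (β : EuclideanSpace ℝ (Fin p)) (z : EuclideanSpace ℝ (Fin p) × ℝ) :
    EuclideanSpace ℝ (Fin p) × ℝ :=
  (z.1, inner ℝ z.1 β + z.2)

theorem betaHat_observe (β : EuclideanSpace ℝ (Fin p)) (z : Fin n → EuclideanSpace ℝ (Fin p) × ℝ)
    (h : IsUnit (gram z).det) :
    betaHat (fun i => observe β (z i))
      = β + mulV (gram z)⁻¹ ((n : ℝ)⁻¹ • ∑ i, (z i).2 • (z i).1) := by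
  have hg : gram (fun i => observe β (z i)) = gram z := rfl
  have hsum : (n : ℝ)⁻¹ • ∑ i, (observe β (z i)).2 • (observe β (z i)).1
      = mulV (gram z) β + (n : ℝ)⁻¹ • ∑ i, (z i).2 • (z i).1 := by
    simp only [observe, add_smul, Finset.sum_add_distrib, smul_add, mulV_gram]
  rw [betaHat, hg, hsum, pinv_eq_inv h, mulV_add, ← mulV_mul, Matrix.nonsing_inv_mul _ h, one_mulV]

theorem inner_VHat (D : Fin n → EuclideanSpace ℝ (Fin p) × ℝ) (u : EuclideanSpace ℝ (Fin p))
    (hS : (pinv (gram D))ᵀ = pinv (gram D)) :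
    inner ℝ u (mulV (VHat D) u)
      = (n : ℝ)⁻¹ * ∑ i, (inner ℝ (mulV (pinv (gram D)) u) (D i).1 * resid D i) ^ 2 := by
  rw [VHat, mulV_mul, mulV_mul, ← inner_mulV_of_symm hS, smul_mulV, sum_mulV,
    real_inner_smul_right, inner_sum]
  congr 1
  refine Finset.sum_congr rfl fun i _ => ?_
  rw [smul_mulV, mulV_outer, real_inner_smul_right, real_inner_smul_right,
    real_inner_comm (mulV _ u)]
  ring

/-- To be used with `Qi = Q⁻¹`, `Si = S⁻¹`, `e` the residuals and `b = β̂ - β₀`, so that `e + ⟨X,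
b⟩` is the true error. Replacing it by `e` costs a square and a cross term in `b`; replacing `Qi u`
by `Si u` costs a square and a cross term in their difference. These four costs are the four terms
of `R_{n,var}`. -/
theorem avg_inner_sq_le {X : Fin n → EuclideanSpace ℝ (Fin p)} {e : Fin n → ℝ}
    {Qi Si : Matrix (Fin p) (Fin p) ℝ} {u b : EuclideanSpace ℝ (Fin p)} {L B d : ℝ}
    (hd0 : 0 ≤ d) (hL : ‖mulV Qi u‖ ≤ L * ‖u‖)
    (hd : ‖mulV Qi u - mulV Si u‖ ≤ d * ‖u‖) (hb : ‖b‖ ≤ B) :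
    (n : ℝ)⁻¹ * ∑ i, (inner ℝ (mulV Qi u) (X i) * (e i + inner ℝ (X i) b)) ^ 2
      ≤ (n : ℝ)⁻¹ * ∑ i, (inner ℝ (mulV Si u) (X i) * e i) ^ 2
        + ‖u‖ ^ 2 * (L ^ 2 * B ^ 2 * ((n : ℝ)⁻¹ * ∑ i, ‖X i‖ ^ 4)
          + 2 * L ^ 2 * B * ((n : ℝ)⁻¹ * ∑ i, ‖X i‖ ^ 3 * |e i|)
          + d ^ 2 * ((n : ℝ)⁻¹ * ∑ i, ‖e i • X i‖ ^ 2)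
          + 2 * d * specNorm ((n : ℝ)⁻¹ • ∑ i, e i ^ 2 • (outer (X i) * Si))) := by
  have hB0 : 0 ≤ B := (norm_nonneg b).trans hb
  set w := mulV Qi u with hw
  set s := mulV Si u with hs
  -- This cross term is not bounded summand by summand: the average is first recognized as `⟨w - s,
  -- N u⟩`, so that only the spectral norm of the averaged matrix enters.
  have hcross : (n : ℝ)⁻¹ * ∑ i, inner ℝ s (X i) * inner ℝ (w - s) (X i) * e i ^ 2
      ≤ ‖u‖ ^ 2 * (d * specNorm ((n : ℝ)⁻¹ • ∑ i, e i ^ 2 • (outer (X i) * Si))) := by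
    set N := (n : ℝ)⁻¹ • ∑ i, e i ^ 2 • (outer (X i) * Si) with hN
    have h1 : (n : ℝ)⁻¹ * ∑ i, inner ℝ s (X i) * inner ℝ (w - s) (X i) * e i ^ 2
        = inner ℝ (w - s) (mulV N u) := by
      rw [hN, smul_mulV, sum_mulV, real_inner_smul_right, inner_sum]
      congr 1
      refine Finset.sum_congr rfl fun i _ => ?_
      rw [smul_mulV, mulV_mul, mulV_outer, real_inner_smul_right, real_inner_smul_right,
        real_inner_comm s]
      ring
    rw [h1]
    have hN0 : 0 ≤ specNorm N := norm_nonneg _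
    calc inner ℝ (w - s) (mulV N u) ≤ ‖w - s‖ * ‖mulV N u‖ := real_inner_le_norm _ _
      _ ≤ (d * ‖u‖) * (specNorm N * ‖u‖) := by
          gcongr
          exact norm_mulV_le_specNorm _ _
      _ = _ := by ring
  have hterm : ∀ i, (inner ℝ w (X i) * (e i + inner ℝ (X i) b)) ^ 2
      ≤ (inner ℝ s (X i) * e i) ^ 2 + 2 * (inner ℝ s (X i) * inner ℝ (w - s) (X i) * e i ^ 2)
        + ‖u‖ ^ 2 * (d ^ 2 * ‖e i • X i‖ ^ 2) + ‖u‖ ^ 2 * (L ^ 2 * B ^ 2 * ‖X i‖ ^ 4)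
        + ‖u‖ ^ 2 * (2 * L ^ 2 * B * (‖X i‖ ^ 3 * |e i|)) := by
    intro i
    have hsplit : (inner ℝ w (X i) : ℝ) = inner ℝ s (X i) + inner ℝ (w - s) (X i) := by
      rw [inner_sub_left]; ring
    have hwX : |(inner ℝ w (X i) : ℝ)| ≤ L * ‖u‖ * ‖X i‖ :=
      (abs_real_inner_le_norm _ _).trans (by gcongr)
    have hbX : |(inner ℝ (X i) b : ℝ)| ≤ B * ‖X i‖ :=
      (abs_real_inner_le_norm _ _).trans (by rw [mul_comm]; gcongr)
    have hdX : |(inner ℝ (w - s) (X i) : ℝ)| ≤ d * ‖u‖ * ‖X i‖ :=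
      (abs_real_inner_le_norm _ _).trans (by gcongr)
    have hwX2 : (inner ℝ w (X i) : ℝ) ^ 2 ≤ (L * ‖u‖ * ‖X i‖) ^ 2 :=
      sq_le_sq' (by linarith [neg_abs_le (inner ℝ w (X i) : ℝ)]) ((le_abs_self _).trans hwX)
    have hbX2 : (inner ℝ (X i) b : ℝ) ^ 2 ≤ (B * ‖X i‖) ^ 2 :=
      sq_le_sq' (by linarith [neg_abs_le (inner ℝ (X i) b : ℝ)]) ((le_abs_self _).trans hbX)
    have hdX2 : (inner ℝ (w - s) (X i) : ℝ) ^ 2 ≤ (d * ‖u‖ * ‖X i‖) ^ 2 :=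
      sq_le_sq' (by linarith [neg_abs_le (inner ℝ (w - s) (X i) : ℝ)])
        ((le_abs_self _).trans hdX)
    have h1 : (inner ℝ (w - s) (X i) * e i) ^ 2 ≤ ‖u‖ ^ 2 * (d ^ 2 * ‖e i • X i‖ ^ 2) := by
      rw [norm_smul, mul_pow, mul_pow, Real.norm_eq_abs, sq_abs]
      nlinarith [mul_le_mul_of_nonneg_right hdX2 (sq_nonneg (e i))]
    have h2 : (inner ℝ w (X i) * inner ℝ (X i) b) ^ 2 ≤ ‖u‖ ^ 2 * (L ^ 2 * B ^ 2 * ‖X i‖ ^ 4) := by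
      rw [mul_pow]
      calc _ ≤ (L * ‖u‖ * ‖X i‖) ^ 2 * (B * ‖X i‖) ^ 2 := by gcongr
        _ = _ := by ring
    have h3 : 2 * (inner ℝ w (X i) ^ 2 * (e i * inner ℝ (X i) b))
        ≤ ‖u‖ ^ 2 * (2 * L ^ 2 * B * (‖X i‖ ^ 3 * |e i|)) := by
      have : e i * inner ℝ (X i) b ≤ |e i| * (B * ‖X i‖) := by
        refine (le_abs_self _).trans ?_
        rw [abs_mul]
        gcongr
      calc _ ≤ 2 * (inner ℝ w (X i) ^ 2 * (|e i| * (B * ‖X i‖))) := by gcongr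
        _ ≤ 2 * ((L * ‖u‖ * ‖X i‖) ^ 2 * (|e i| * (B * ‖X i‖))) := by gcongr
        _ = _ := by ring
    have h4 : (inner ℝ w (X i) * (e i + inner ℝ (X i) b)) ^ 2
        = (inner ℝ w (X i) * e i) ^ 2 + (inner ℝ w (X i) * inner ℝ (X i) b) ^ 2
          + 2 * (inner ℝ w (X i) ^ 2 * (e i * inner ℝ (X i) b)) := by ring
    have h5 : (inner ℝ w (X i) * e i) ^ 2 = (inner ℝ s (X i) * e i) ^ 2
        + 2 * (inner ℝ s (X i) * inner ℝ (w - s) (X i) * e i ^ 2)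
        + (inner ℝ (w - s) (X i) * e i) ^ 2 := by
      rw [hsplit]; ring
    rw [h4, h5]
    linarith
  have hn : 0 ≤ (n : ℝ)⁻¹ := by positivity
  have hsum := mul_le_mul_of_nonneg_left
    (Finset.sum_le_sum fun i (_ : i ∈ Finset.univ) => hterm i) hn
  refine hsum.trans ?_
  simp only [Finset.sum_add_distrib, ← Finset.mul_sum]
  linarith

/-- The conclusions that hold on the event where the rotated Gram matrix is close to the identity
and the rotated score is bounded. -/
theorem linearization {z : Fin n → EuclideanSpace ℝ (Fin p) × ℝ} {Q R : Matrix (Fin p) (Fin p) ℝ}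
    {u β : EuclideanSpace ℝ (Fin p)} {lam g r : ℝ} (hlam : 0 < lam) (hR : Rᵀ = R)
    (hRQR : R * Q * R = 1)
    (hQ : ∀ v : EuclideanSpace ℝ (Fin p), lam * ‖v‖ ^ 2 ≤ inner ℝ v (mulV Q v))
    (hg0 : 0 ≤ g) (hg : g < 1)
    (hG : ‖WithLp.toLp 2 (R * gram z * R - 1).vec‖ ≤ g)
    (hr : ‖(n : ℝ)⁻¹ • ∑ i, (z i).2 • mulV R (z i).1‖ ≤ r) :
    |inner ℝ u (betaHat fun i => observe β (z i)) - inner ℝ u β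
        - (n : ℝ)⁻¹ * ∑ i, inner ℝ u (mulV Q⁻¹ (z i).1) * (z i).2|
      ≤ lam ^ (-(1 / 2) : ℝ) * ‖u‖ * (g / (1 - g)) * r
    ∧ (n : ℝ)⁻¹ * ∑ i, (inner ℝ u (mulV Q⁻¹ (z i).1) * (z i).2) ^ 2
      ≤ inner ℝ u (mulV (VHat fun i => observe β (z i)) u)
        + ‖u‖ ^ 2 * (lam⁻¹ ^ 2 * (lam ^ (-(1 / 2) : ℝ) * (g / (1 - g) + 1) * r) ^ 2
            * ((n : ℝ)⁻¹ * ∑ i, ‖(z i).1‖ ^ 4)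
          + 2 * lam⁻¹ ^ 2 * (lam ^ (-(1 / 2) : ℝ) * (g / (1 - g) + 1) * r)
            * ((n : ℝ)⁻¹ * ∑ i, ‖(z i).1‖ ^ 3 * |resid (fun i => observe β (z i)) i|)
          + (lam⁻¹ * (g / (1 - g))) ^ 2
            * ((n : ℝ)⁻¹ * ∑ i, ‖resid (fun i => observe β (z i)) i • (z i).1‖ ^ 2)
          + 2 * (lam⁻¹ * (g / (1 - g)))
            * specNorm ((n : ℝ)⁻¹ • ∑ i, resid (fun i => observe β (z i)) i ^ 2
              • (outer (z i).1 * pinv (gram z)))) := by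
  set l := lam ^ (-(1 / 2) : ℝ) with hl
  have hl0 : 0 ≤ l := by positivity
  have hl2 : l * l = lam⁻¹ := by rw [← sq, hl, rpow_neg_half_sq hlam]
  have hRn : ∀ v, ‖mulV R v‖ ≤ l * ‖v‖ := norm_mulV_le_of_mul_mul_eq_one hlam hR hRQR hQ
  set S := gram z with hS
  have hSt : Sᵀ = S := gram_transpose z
  have hh0 : 0 ≤ g / (1 - g) := div_nonneg hg0 (by linarith)
  set h := g / (1 - g) with hh
  have hr0 : 0 ≤ r := (norm_nonneg _).trans hr
  -- With `T = RSR - 1` the spectral norm is dominated by the norm of the vectorization. The inverse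
  -- `1 + W` of `RSR` yields `S⁻¹ = R(1 + W)R`, so `S⁻¹ - Q⁻¹ = RWR`.
  obtain ⟨W, hW1, hW⟩ := exists_inverse_one_add (T := R * S * R - 1) hg0 hg fun v =>
    (norm_mulV_le_vec _ v).trans (by gcongr)
  rw [add_sub_cancel] at hW1
  have hQi : Q⁻¹ = R * R := inv_eq_mul_of_mul_mul_eq_one hRQR
  have hRR : R * (S * R * (1 + W)) = 1 := by
    simpa only [Matrix.mul_assoc] using hW1
  have hSmul : S * (R * (1 + W) * R) = 1 := by
    simpa only [Matrix.mul_assoc] using mul_eq_one_comm.1 hRR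
  have hSi : S⁻¹ = R * (1 + W) * R := Matrix.inv_eq_right_inv hSmul
  have hSu : IsUnit S.det := (Matrix.isUnit_iff_isUnit_det _).1
    (IsUnit.of_mul_eq_one _ hSmul)
  have hpinv : pinv S = S⁻¹ := pinv_eq_inv hSu
  have hSit : (S⁻¹)ᵀ = S⁻¹ := by rw [Matrix.transpose_nonsing_inv, hSt]
  have hQit : (Q⁻¹)ᵀ = Q⁻¹ := by rw [hQi, Matrix.transpose_mul, hR]
  set x := (n : ℝ)⁻¹ • ∑ i, (z i).2 • (z i).1 with hx
  have hRx : mulV R x = (n : ℝ)⁻¹ • ∑ i, (z i).2 • mulV R (z i).1 := by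
    simp only [hx, mulV_smul, mulV_sum]
  rw [← hRx] at hr
  have hbeta := betaHat_observe β z hSu
  rw [← hx] at hbeta
  have hsplit : mulV S⁻¹ x = mulV Q⁻¹ x + mulV R (mulV W (mulV R x)) := by
    rw [hSi, hQi]
    simp only [mulV_mul, add_mulV, one_mulV, mulV_add]
  have hb : ‖mulV S⁻¹ x‖ ≤ l * (h + 1) * r := by
    rw [hsplit, hQi, mulV_mul, ← mulV_add]
    calc _ ≤ l * ‖mulV R x + mulV W (mulV R x)‖ := hRn _
      _ ≤ l * (‖mulV R x‖ + h * ‖mulV R x‖) := by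
          gcongr
          exact (norm_add_le _ _).trans (by gcongr; exact hW _)
      _ = l * (h + 1) * ‖mulV R x‖ := by ring
      _ ≤ _ := by gcongr
  constructor
  · have hxi : (n : ℝ)⁻¹ * ∑ i, inner ℝ u (mulV Q⁻¹ (z i).1) * (z i).2
        = inner ℝ u (mulV Q⁻¹ x) := by
      simp only [hx, mulV_smul, mulV_sum, real_inner_smul_right, inner_sum]
      congr 1
      exact Finset.sum_congr rfl fun i _ => mul_comm _ _
    rw [hxi, hbeta, inner_add_right, hsplit, inner_add_right]
    have : (inner ℝ u β + (inner ℝ u (mulV Q⁻¹ x) + inner ℝ u (mulV R (mulV W (mulV R x))))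
        - inner ℝ u β - inner ℝ u (mulV Q⁻¹ x) : ℝ)
        = inner ℝ (mulV R u) (mulV W (mulV R x)) := by
      rw [inner_mulV_of_symm hR]; ring
    rw [this]
    calc _ ≤ ‖mulV R u‖ * ‖mulV W (mulV R x)‖ := abs_real_inner_le_norm _ _
      _ ≤ (l * ‖u‖) * (h * ‖mulV R x‖) := by
          gcongr
          · exact hRn u
          · exact hW _
      _ ≤ (l * ‖u‖) * (h * r) := by gcongr
      _ = _ := by ring
  · have hL : ‖mulV Q⁻¹ u‖ ≤ lam⁻¹ * ‖u‖ := by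
      rw [hQi, mulV_mul, ← hl2, mul_assoc]
      exact (hRn _).trans (by gcongr; exact hRn u)
    have hd : ‖mulV Q⁻¹ u - mulV S⁻¹ u‖ ≤ lam⁻¹ * h * ‖u‖ := by
      have : mulV Q⁻¹ u - mulV S⁻¹ u = -mulV R (mulV W (mulV R u)) := by
        rw [hSi, hQi]
        simp only [mulV_mul, add_mulV, one_mulV, mulV_add]
        abel
      rw [this, norm_neg, ← hl2]
      calc _ ≤ l * ‖mulV W (mulV R u)‖ := hRn _
        _ ≤ l * (h * (l * ‖u‖)) := by
            gcongr
            exact (hW _).trans (by gcongr; exact hRn u)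
        _ = _ := by ring
    have key := avg_inner_sq_le (X := fun i => (z i).1)
      (e := fun i => resid (fun i => observe β (z i)) i) (by positivity) hL hd hb
    have hres : ∀ i, resid (fun i => observe β (z i)) i + inner ℝ (z i).1 (mulV S⁻¹ x)
        = (z i).2 := by
      intro i
      rw [resid, hbeta]
      simp only [observe, inner_add_right]
      ring
    have hV := inner_VHat (fun i => observe β (z i)) u (by
      change (pinv S)ᵀ = pinv S
      rw [hpinv, hSit])
    change _ = (n : ℝ)⁻¹ * ∑ i, (inner ℝ (mulV (pinv S) u) (z i).1
      * resid (fun i => observe β (z i)) i) ^ 2 at hV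
    rw [hV, hpinv]
    simp only [hres] at key
    simp only [← inner_mulV_of_symm hQit]
    exact key

end Deterministic

/-! ### Normal approximation of the standardized sum -/

section Normal

theorem Phi_neg (x : ℝ) : Phi (-x) = 1 - Phi x := by
  have hmap : (gaussianReal 0 1).map (fun y : ℝ => -y) = gaussianReal 0 1 := by
    rw [gaussianReal_map_neg, neg_zero]
  have h1 : (gaussianReal 0 1).real (Set.Iic (-x)) = (gaussianReal 0 1).real (Set.Ici x) := by
    conv_lhs => rw [← hmap]
    rw [map_measureReal_apply measurable_neg measurableSet_Iic]
    congr 1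
    ext y
    simp
  rw [Phi, Phi, cdf_eq_real, cdf_eq_real, h1, ← Set.compl_Iio, probReal_compl_eq_one_sub
    measurableSet_Iio]
  congr 1
  have : NullSingletonClass (gaussianReal 0 1) := nullSingletonClass_gaussianReal one_ne_zero
  exact measureReal_congr Iio_ae_eq_Iic

/-- The infimum defining the quantile is attained, by right-continuity of the distribution function.
-/
theorem Phi_gaussQuantile {τ : ℝ} (h0 : 0 < τ) (h1 : τ < 1) : τ ≤ Phi (gaussQuantile τ) := by
  have hne : {x : ℝ | τ ≤ Phi x}.Nonempty :=
    (((tendsto_cdf_atTop (gaussianReal 0 1)).eventually (lt_mem_nhds h1)).exists).imp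
      fun x hx => le_of_lt hx
  have hbdd : BddBelow {x : ℝ | τ ≤ Phi x} := by
    obtain ⟨b, hb⟩ := ((tendsto_cdf_atBot (gaussianReal 0 1)).eventually (gt_mem_nhds h0)).exists
    refine ⟨b, fun x hx => le_of_lt ?_⟩
    by_contra hlt
    exact absurd (hx.trans (monotone_cdf (gaussianReal 0 1) (not_lt.1 hlt))) (not_le.2 hb)
  have hcont : ContinuousWithinAt Phi (Set.Ioi (gaussQuantile τ)) (gaussQuantile τ) :=
    ((cdf (gaussianReal 0 1)).right_continuous _).mono Set.Ioi_subset_Ici_self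
  refine ge_of_tendsto hcont ?_
  filter_upwards [self_mem_nhdsWithin] with x hx
  obtain ⟨y, hy, hyx⟩ := (csInf_lt_iff hbdd hne).1 hx
  exact le_trans (show τ ≤ Phi y from hy) (monotone_cdf (gaussianReal 0 1) hyx.le)

theorem gaussQuantile_nonneg {τ : ℝ} (h0 : 1 / 2 < τ) (h1 : τ < 1) : 0 ≤ gaussQuantile τ := by
  by_contra hlt
  have h2 := Phi_gaussQuantile (by linarith) h1
  have h3 : Phi (gaussQuantile τ) ≤ Phi 0 := monotone_cdf (gaussianReal 0 1) (not_le.1 hlt).le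
  have h4 := Phi_neg 0
  rw [neg_zero] at h4
  linarith

/-- Any finite bound would do: it makes the family defining `deltaE` bounded. A real supremum of an
unbounded family is `0` by convention and would bound nothing. -/
theorem abs_one_sub_sq_mul_gaussianPDFReal_le (x : ℝ) :
    |(1 - x ^ 2) * gaussianPDFReal 0 1 x| ≤ 2 := by
  have h1 : gaussianPDFReal 0 1 x ≤ Real.exp (-(x ^ 2 / 2)) := by
    rw [gaussianPDFReal]
    have : (√(2 * Real.pi * ((1 : NNReal) : ℝ)))⁻¹ ≤ 1 := by
      apply inv_le_one_of_one_le₀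
      rw [Real.one_le_sqrt, NNReal.coe_one]
      linarith [Real.pi_gt_three]
    calc _ ≤ 1 * Real.exp (-(x - 0) ^ 2 / (2 * ((1 : NNReal) : ℝ))) := by gcongr
      _ = _ := by rw [one_mul, NNReal.coe_one]; congr 1; ring
  have h2 : |1 - x ^ 2| ≤ 2 * Real.exp (x ^ 2 / 2) := by
    have := Real.add_one_le_exp (x ^ 2 / 2)
    rw [abs_le]
    constructor <;> nlinarith [sq_nonneg x]
  rw [abs_mul, abs_of_nonneg (gaussianPDFReal_nonneg 0 1 x)]
  calc _ ≤ 2 * Real.exp (x ^ 2 / 2) * Real.exp (-(x ^ 2 / 2)) := by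
        gcongr
        exact gaussianPDFReal_nonneg 0 1 x
    _ = 2 := by rw [mul_assoc, ← Real.exp_add]; simp

theorem abs_cdfStdSum_sub_Phi_le_one (n : ℕ) (ν : Measure ℝ) [IsProbabilityMeasure ν] (x : ℝ) :
    |cdfStdSum n ν x - Phi x| ≤ 1 := by
  have h1 : cdfStdSum n ν x ∈ Set.Icc (0 : ℝ) 1 := ⟨measureReal_nonneg, measureReal_le_one⟩
  have h2 : Phi x ∈ Set.Icc (0 : ℝ) 1 := ⟨cdf_nonneg _ x, cdf_le_one _ x⟩
  rw [abs_le]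
  constructor <;> linarith [h1.1, h1.2, h2.1, h2.2]

/-- The Edgeworth correction takes the same value at `x` and `-x`, so it drops out of the
difference; each of the two points costs one distance. -/
theorem cdfStdSum_sub_ge (n : ℕ) (ν : Measure ℝ) [IsProbabilityMeasure ν] (x : ℝ) :
    Phi x - Phi (-x) - 2 * min (deltaE n ν) (deltaB n ν)
      ≤ cdfStdSum n ν x - cdfStdSum n ν (-x) := by
  rcases min_choice (deltaE n ν) (deltaB n ν) with h | h <;> rw [h]
  · have hb : BddAbove (Set.range fun x : ℝ => |cdfStdSum n ν x - Phi x
        - lambda3 ν / (6 * √(n : ℝ)) * (1 - x ^ 2) * gaussianPDFReal 0 1 x|) := by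
      refine ⟨1 + |lambda3 ν / (6 * √(n : ℝ))| * 2, ?_⟩
      rintro _ ⟨y, rfl⟩
      refine (abs_sub _ _).trans (add_le_add (abs_cdfStdSum_sub_Phi_le_one n ν y) ?_)
      rw [mul_assoc, abs_mul]
      exact mul_le_mul_of_nonneg_left (abs_one_sub_sq_mul_gaussianPDFReal_le y) (abs_nonneg _)
    have h1 := (abs_le.1 (le_ciSup hb x)).1
    have h2 := (abs_le.1 (le_ciSup hb (-x))).2
    have hpdf : gaussianPDFReal 0 1 (-x) = gaussianPDFReal 0 1 x := by simp [gaussianPDFReal]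
    rw [hpdf, neg_sq] at h2
    change -deltaE n ν ≤ _ at h1
    change _ ≤ deltaE n ν at h2
    linarith
  · have hb : BddAbove (Set.range fun x : ℝ => |cdfStdSum n ν x - Phi x|) :=
      ⟨1, by rintro _ ⟨y, rfl⟩; exact abs_cdfStdSum_sub_Phi_le_one n ν y⟩
    have h1 := (abs_le.1 (le_ciSup hb x)).1
    have h2 := (abs_le.1 (le_ciSup hb (-x))).2
    change -deltaB n ν ≤ _ at h1
    change _ ≤ deltaB n ν at h2
    linarith

end Normal

/-! ### Measurability of the coverage event -/

section Measurability

variable {p n : ℕ}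

theorem continuous_mulV :
    Continuous fun q : Matrix (Fin p) (Fin p) ℝ × EuclideanSpace ℝ (Fin p) => mulV q.1 q.2 := by
  unfold mulV
  fun_prop

theorem measurable_mulV {Ω : Type*} [MeasurableSpace Ω] {A : Ω → Matrix (Fin p) (Fin p) ℝ}
    {x : Ω → EuclideanSpace ℝ (Fin p)} (hA : Measurable A) (hx : Measurable x) :
    Measurable fun ω => mulV (A ω) (x ω) :=
  continuous_mulV.measurable.comp (hA.prodMk hx)

theorem continuous_outer : Continuous (outer (p := p)) := by
  unfold outer
  refine continuous_matrix fun i j => ?_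
  simp only [Matrix.of_apply]
  fun_prop

theorem measurable_outer_fst (i : Fin n) :
    Measurable fun D : Fin n → EuclideanSpace ℝ (Fin p) × ℝ => outer (D i).1 :=
  continuous_outer.measurable.comp (by fun_prop)

theorem measurable_gram :
    Measurable (gram : (Fin n → EuclideanSpace ℝ (Fin p) × ℝ) → Matrix (Fin p) (Fin p) ℝ) := by
  have := measurable_outer_fst (p := p) (n := n)
  unfold gram
  fun_prop

theorem measurable_betaHat :
    Measurable (betaHat : (Fin n → EuclideanSpace ℝ (Fin p) × ℝ) → EuclideanSpace ℝ (Fin p)) :=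
  measurable_mulV (measurable_pinv.comp measurable_gram) (by fun_prop)

theorem measurable_resid (i : Fin n) :
    Measurable fun D : Fin n → EuclideanSpace ℝ (Fin p) × ℝ => resid D i := by
  have := measurable_betaHat (p := p) (n := n)
  unfold resid
  fun_prop

theorem measurable_VHat :
    Measurable (VHat : (Fin n → EuclideanSpace ℝ (Fin p) × ℝ) → Matrix (Fin p) (Fin p) ℝ) := by
  have hp := measurable_pinv (p := p)
  have hg := measurable_gram (p := p) (n := n)
  have ho := measurable_outer_fst (p := p) (n := n)
  have hr := measurable_resid (p := p) (n := n)
  unfold VHat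
  fun_prop

theorem measurable_RVar (K : Bounds) (γ : ℝ) :
    Measurable fun D : Fin n → EuclideanSpace ℝ (Fin p) × ℝ => RVar D K γ := by
  have hr := measurable_resid (p := p) (n := n)
  have ho := measurable_outer_fst (p := p) (n := n)
  have hg := measurable_gram (p := p) (n := n)
  have hp := measurable_pinv (p := p)
  have hs : Measurable fun D : Fin n → EuclideanSpace ℝ (Fin p) × ℝ =>
      specNorm ((n : ℝ)⁻¹ • ∑ i, resid D i ^ 2 • (outer (D i).1 * pinv (gram D))) :=
    continuous_specNorm.measurable.comp (by fun_prop)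
  unfold RVar
  fun_prop

theorem measurable_halfWidth (u : EuclideanSpace ℝ (Fin p)) (α : ℝ) (K : Bounds) (t : Tuning) :
    Measurable fun D : Fin n → EuclideanSpace ℝ (Fin p) × ℝ => halfWidth u α K t D := by
  have hv := measurable_mulV (measurable_VHat (p := p) (n := n)) (measurable_const (a := u))
  have hR := measurable_RVar (p := p) (n := n) K (t.omega n * α / 2)
  unfold halfWidth enlargedVar
  fun_prop

theorem measurableSet_mem_CIEdg (u : EuclideanSpace ℝ (Fin p)) (α : ℝ) (K : Bounds) (t : Tuning)
    (c : ℝ) :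
    MeasurableSet {D : Fin n → EuclideanSpace ℝ (Fin p) × ℝ | c ∈ CIEdg u α K t D} := by
  unfold CIEdg
  split_ifs with h
  · simp
  · have hb := measurable_betaHat (p := p) (n := n)
    have hh := measurable_halfWidth (p := p) (n := n) u α K t
    have h1 : Measurable fun D : Fin n → EuclideanSpace ℝ (Fin p) × ℝ =>
        (inner ℝ u (betaHat D) : ℝ) := by fun_prop
    exact (measurableSet_le (h1.sub hh) measurable_const).inter
      (measurableSet_le measurable_const (h1.add hh))

end Measurability

/-! ### The remainder terms -/

section Rates

variable {p n : ℕ}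

theorem rpow_quarter_sq {x : ℝ} (hx : 0 ≤ x) : (x ^ (1 / 4 : ℝ)) ^ 2 = √x := by
  rw [← Real.rpow_natCast, ← Real.rpow_mul hx, Real.sqrt_eq_rpow]
  norm_num

theorem RLin_div_sqrt (u : EuclideanSpace ℝ (Fin p)) (K : Bounds) (γ : ℝ) :
    K.lamReg ^ (-(1 / 2) : ℝ) * ‖u‖ * (gammaTilde K n γ / (1 - gammaTilde K n γ))
        * (√2 * (K.KEps / γ) ^ (1 / 4 : ℝ) / √(n : ℝ))
      = RLin u K n γ / √(n : ℝ) := by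
  rw [RLin]
  ring

/-- Matches the deterministic bound of `linearization`, at the score radius of event (B), with the
definition of `R_{n,var}`. -/
theorem RVar_eq (D : Fin n → EuclideanSpace ℝ (Fin p) × ℝ) (K : Bounds) {γ : ℝ}
    (hn : 1 ≤ n) (hlam : 0 < K.lamReg) (hReg : 0 < K.KReg) (hEps : 0 < K.KEps) (hγ : 0 < γ) :
    K.lamReg⁻¹ ^ 2 * (K.lamReg ^ (-(1 / 2) : ℝ)
            * (gammaTilde K n γ / (1 - gammaTilde K n γ) + 1)
            * (√2 * (K.KEps / γ) ^ (1 / 4 : ℝ) / √(n : ℝ))) ^ 2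
            * ((n : ℝ)⁻¹ * ∑ i, ‖(D i).1‖ ^ 4)
          + 2 * K.lamReg⁻¹ ^ 2 * (K.lamReg ^ (-(1 / 2) : ℝ)
            * (gammaTilde K n γ / (1 - gammaTilde K n γ) + 1)
            * (√2 * (K.KEps / γ) ^ (1 / 4 : ℝ) / √(n : ℝ)))
            * ((n : ℝ)⁻¹ * ∑ i, ‖(D i).1‖ ^ 3 * |resid D i|)
          + (K.lamReg⁻¹ * (gammaTilde K n γ / (1 - gammaTilde K n γ))) ^ 2
            * ((n : ℝ)⁻¹ * ∑ i, ‖resid D i • (D i).1‖ ^ 2)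
          + 2 * (K.lamReg⁻¹ * (gammaTilde K n γ / (1 - gammaTilde K n γ)))
            * specNorm ((n : ℝ)⁻¹ • ∑ i, resid D i ^ 2 • (outer (D i).1 * pinv (gram D)))
      = RVar D K γ := by
  have hn0 : (0 : ℝ) < n := by exact_mod_cast hn
  have hl2 := rpow_neg_half_sq hlam
  have hk2 := rpow_quarter_sq (x := K.KEps / γ) (by positivity)
  have hs : √(n : ℝ) ^ 2 = n := Real.sq_sqrt hn0.le
  have hg2 : gammaTilde K n γ ^ 2 = K.KReg / (n * γ) := Real.sq_sqrt (by positivity)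
  have h52 : K.lamReg ^ (5 / 2 : ℝ) * K.lamReg ^ (-(1 / 2) : ℝ) = K.lamReg ^ 2 := by
    rw [← Real.rpow_add hlam, ← Real.rpow_natCast]
    norm_num
  have h5 : 0 < K.lamReg ^ (5 / 2 : ℝ) := by positivity
  have hl : K.lamReg ^ (-(1 / 2) : ℝ) = K.lamReg ^ 2 / K.lamReg ^ (5 / 2 : ℝ) := by
    rw [eq_div_iff h5.ne', mul_comm, h52]
  rw [RVar]
  congr 1
  congr 1
  congr 1
  · rw [div_eq_mul_inv _ (√(n : ℝ)), mul_pow, mul_pow, mul_pow, mul_pow, hl2, hk2,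
      inv_pow (√(n : ℝ)), hs, Real.sq_sqrt (by norm_num : (0 : ℝ) ≤ 2)]
    field_simp
  · rw [hl]
    field_simp
  · rw [← hg2]
    simp only [div_eq_mul_inv, mul_inv, mul_pow, inv_pow]
    ring
  · simp only [div_eq_mul_inv, mul_inv]
    ring

end Rates

/-! ### Population moments -/

section Population

variable {p : ℕ}

instance (θ : Param p) : IsProbabilityMeasure θ.meas :=
  θ.law.2

theorem abs_outer_le (x : EuclideanSpace ℝ (Fin p)) (i j : Fin p) : |outer x i j| ≤ ‖x‖ ^ 2 := by
  rw [outer, Matrix.of_apply, abs_mul, sq]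
  exact mul_le_mul (PiLp.norm_apply_le x i) (PiLp.norm_apply_le x j) (abs_nonneg _) (norm_nonneg _)

theorem norm_toLp_vec_outer (x : EuclideanSpace ℝ (Fin p)) :
    ‖WithLp.toLp 2 (outer x).vec‖ = ‖x‖ ^ 2 := by
  refine (sq_eq_sq₀ (norm_nonneg _) (by positivity)).1 ?_
  rw [norm_toLp_vec_sq, EuclideanSpace.real_norm_sq_eq, sq (∑ i, _), Finset.sum_mul_sum]
  exact Finset.sum_congr rfl fun i _ => Finset.sum_congr rfl fun j _ => by
    rw [outer, Matrix.of_apply, mul_pow]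

theorem secondMoment_transpose (θ : Param p) : θ.secondMomentᵀ = θ.secondMoment := by
  ext i j
  simp only [Param.secondMoment, Matrix.transpose_apply, Matrix.of_apply, outer, mul_comm]

theorem scoreMoment_transpose (θ : Param p) : θ.scoreMomentᵀ = θ.scoreMoment := by
  ext i j
  simp only [Param.scoreMoment, Matrix.transpose_apply, Matrix.of_apply, outer]
  exact integral_congr_ae (ae_of_all _ fun z => by ring)

theorem continuous_mulV_const (A : Matrix (Fin p) (Fin p) ℝ) : Continuous (mulV A) :=
  (Matrix.toEuclideanCLM (n := Fin p) (𝕜 := ℝ) A).continuous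

theorem continuous_xi (θ : Param p) (u : EuclideanSpace ℝ (Fin p)) : Continuous (θ.xi u) := by
  have := continuous_mulV_const θ.secondMoment⁻¹
  unfold Param.xi
  fun_prop

theorem continuous_rot (θ : Param p) : Continuous θ.rot := continuous_mulV_const _

theorem integral_mul_mul_apply {Ω : Type*} [MeasurableSpace Ω] {P : Measure Ω}
    {f : Ω → Matrix (Fin p) (Fin p) ℝ} (hf : ∀ i j, Integrable (fun ω => f ω i j) P)
    (A B : Matrix (Fin p) (Fin p) ℝ) (i j : Fin p) :
    Integrable (fun ω => (A * f ω * B) i j) P ∧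
      ∫ ω, (A * f ω * B) i j ∂P = (A * (Matrix.of fun k l => ∫ ω, f ω k l ∂P) * B) i j := by
  simp only [Matrix.mul_apply, Matrix.of_apply, Finset.sum_mul]
  have h : ∀ k l, Integrable (fun ω => A i l * f ω l k * B k j) P := fun k l =>
    ((hf l k).const_mul _).mul_const _
  refine ⟨integrable_finsetSum _ fun k _ => integrable_finsetSum _ fun l _ => h k l, ?_⟩
  rw [integral_finsetSum _ fun k _ => integrable_finsetSum _ fun l _ => h k l]
  refine Finset.sum_congr rfl fun k _ => ?_
  rw [integral_finsetSum _ fun l _ => h k l]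
  refine Finset.sum_congr rfl fun l _ => ?_
  rw [integral_mul_const, integral_const_mul]

theorem integrable_outer {θ : Param p} (hθ : θ ∈ modelSet p) (i j : Fin p) :
    Integrable (fun z => outer z.1 i j) θ.meas := by
  refine ((integrable_const (1 : ℝ)).add hθ.2.2.1).mono' ?_ (ae_of_all _ fun z => ?_)
  · have : Continuous fun z : EuclideanSpace ℝ (Fin p) × ℝ => outer z.1 i j :=
      (continuous_outer.comp continuous_fst).matrix_elem i j
    exact this.aestronglyMeasurable
  · refine (abs_outer_le _ _ _).trans ?_
    change _ ≤ 1 + ‖z.1‖ ^ 4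
    nlinarith [sq_nonneg (‖z.1‖ ^ 2 - 1)]

theorem integrable_smul_fst {θ : Param p} (hθ : θ ∈ modelSet p) :
    Integrable (fun z => z.2 • z.1) θ.meas := by
  refine ((integrable_const (1 : ℝ)).add hθ.1).mono' ?_ (ae_of_all _ fun z => ?_)
  · exact (by fun_prop : Continuous fun z : EuclideanSpace ℝ (Fin p) × ℝ =>
      z.2 • z.1).aestronglyMeasurable
  · change _ ≤ 1 + ‖z.1‖ ^ 2 * z.2 ^ 2
    rw [norm_smul, Real.norm_eq_abs, ← sq_abs z.2]
    nlinarith [sq_nonneg (|z.2| * ‖z.1‖ - 1)]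

theorem integral_smul_rot {θ : Param p} (hθ : θ ∈ modelSet p) :
    ∫ z, z.2 • θ.rot z.1 ∂θ.meas = 0 := by
  have h := (Matrix.toEuclideanCLM (n := Fin p) (𝕜 := ℝ)
    (invSqrt θ.secondMoment)).integral_comp_comm (integrable_smul_fst hθ)
  rw [hθ.2.1, map_zero] at h
  rw [← h]
  simp only [map_smul]
  rfl

theorem xi_eq_inner (θ : Param p) (u : EuclideanSpace ℝ (Fin p))
    (z : EuclideanSpace ℝ (Fin p) × ℝ) :
    θ.xi u z = inner ℝ (mulV θ.secondMoment⁻¹ u) (z.2 • z.1) := by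
  have h : (θ.secondMoment⁻¹)ᵀ = θ.secondMoment⁻¹ := by
    rw [Matrix.transpose_nonsing_inv, secondMoment_transpose]
  rw [Param.xi, ← inner_mulV_of_symm h, real_inner_smul_right, mul_comm]

theorem integral_xi {θ : Param p} (hθ : θ ∈ modelSet p) (u : EuclideanSpace ℝ (Fin p)) :
    ∫ z, θ.xi u z ∂θ.meas = 0 := by
  simp only [xi_eq_inner]
  rw [integral_inner (integrable_smul_fst hθ), hθ.2.1, inner_zero_right]

theorem rot_mul_mul_rot {θ : Param p} (hθ : θ ∈ modelSet p) :
    invSqrt θ.secondMoment * θ.secondMoment * invSqrt θ.secondMoment = 1 :=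
  invSqrt_mul_mul_invSqrt (secondMoment_transpose θ) hθ.2.2.2.1

/-- `E[ξ²]` is the quadratic form of `E[XX'ε²]` at `w = E[XX']⁻¹u`, which is nonzero since `u` is.
-/
theorem integral_xi_sq_pos {θ : Param p} (hθ : θ ∈ modelSet p) {u : EuclideanSpace ℝ (Fin p)}
    (hu : u ≠ 0) : 0 < ∫ z, θ.xi u z ^ 2 ∂θ.meas := by
  set w := mulV θ.secondMoment⁻¹ u with hw
  have hdet : IsUnit θ.secondMoment.det := by
    have h := rot_mul_mul_rot hθ
    rw [Matrix.mul_assoc, mul_eq_one_comm, Matrix.mul_assoc] at h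
    exact (Matrix.isUnit_iff_isUnit_det _).1 (IsUnit.of_mul_eq_one _ h)
  have hw0 : w ≠ 0 := by
    intro h0
    apply hu
    rw [← one_mulV u, ← Matrix.mul_nonsing_inv _ hdet, mulV_mul, ← hw, h0]
    simp [mulV_eq_toEuclideanCLM]
  have hint : ∀ i j, Integrable (fun z => outer z.1 i j * z.2 ^ 2) θ.meas := by
    intro i j
    refine hθ.1.mono' ?_ (ae_of_all _ fun z => ?_)
    · have : Continuous fun z : EuclideanSpace ℝ (Fin p) × ℝ => outer z.1 i j :=
        (continuous_outer.comp continuous_fst).matrix_elem i j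
      exact (this.mul (continuous_snd.pow 2)).aestronglyMeasurable
    · rw [Real.norm_eq_abs, abs_mul, abs_of_nonneg (sq_nonneg z.2)]
      exact mul_le_mul_of_nonneg_right (abs_outer_le _ _ _) (sq_nonneg _)
  have heq : ∫ z, θ.xi u z ^ 2 ∂θ.meas = inner ℝ w (mulV θ.scoreMoment w) := by
    have h1 : ∀ z, θ.xi u z ^ 2 = ∑ i, ∑ j, w i * w j * (outer z.1 i j * z.2 ^ 2) := by
      intro z
      rw [xi_eq_inner, ← hw, real_inner_smul_right, PiLp.inner_apply, mul_pow, sq (∑ i, _),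
        Finset.sum_mul_sum, Finset.mul_sum]
      refine Finset.sum_congr rfl fun i _ => ?_
      rw [Finset.mul_sum]
      refine Finset.sum_congr rfl fun j _ => ?_
      simp only [outer, Matrix.of_apply, RCLike.inner_apply, conj_trivial]
      ring
    simp only [h1]
    rw [integral_finsetSum _ fun i _ => integrable_finsetSum _ fun j _ => (hint i j).const_mul _,
      PiLp.inner_apply]
    refine Finset.sum_congr rfl fun i _ => ?_
    rw [integral_finsetSum _ fun j _ => (hint i j).const_mul _]
    simp only [mulV, Matrix.mulVec, dotProduct, RCLike.inner_apply, conj_trivial,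
      Param.scoreMoment, Matrix.of_apply, Finset.sum_mul]
    refine Finset.sum_congr rfl fun j _ => ?_
    rw [integral_const_mul]
    ring
  rw [heq]
  refine lt_of_lt_of_le ?_ (lamMin_mul_le_inner (scoreMoment_transpose θ) w)
  have := hθ.2.2.2.2
  have := norm_pos_iff.2 hw0
  positivity

theorem memLp_smul_rot {θ : Param p} (h : Integrable (fun z => ‖z.2 • θ.rot z.1‖ ^ 4) θ.meas) :
    MemLp (fun z => z.2 • θ.rot z.1) 4 θ.meas := by
  have hm : AEStronglyMeasurable (fun z => z.2 • θ.rot z.1) θ.meas := by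
    have := continuous_rot θ
    exact (by fun_prop : Continuous fun z : EuclideanSpace ℝ (Fin p) × ℝ =>
      z.2 • θ.rot z.1).aestronglyMeasurable
  rw [← integrable_norm_rpow_iff hm (by norm_num) (by norm_num)]
  refine h.congr (ae_of_all _ fun z => ?_)
  simp only [ENNReal.toReal_ofNat]
  norm_cast

/-- `ξ = ⟨Ru, εX̃⟩` with `R = E[XX']^{-1/2}`, so Cauchy–Schwarz passes the fourth moment of `εX̃` on
to `ξ`. -/
theorem integrable_xi_pow_four {θ : Param p} (hθ : θ ∈ modelSet p)
    (h : Integrable (fun z => ‖z.2 • θ.rot z.1‖ ^ 4) θ.meas) (u : EuclideanSpace ℝ (Fin p)) :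
    Integrable (fun z => θ.xi u z ^ 4) θ.meas := by
  refine (h.const_mul (‖mulV (invSqrt θ.secondMoment) u‖ ^ 4)).mono'
    ((continuous_xi θ u).pow 4).aestronglyMeasurable (ae_of_all _ fun z => ?_)
  have : θ.xi u z = inner ℝ (mulV (invSqrt θ.secondMoment) u) (z.2 • θ.rot z.1) := by
    rw [Param.xi, inv_eq_mul_of_mul_mul_eq_one (rot_mul_mul_rot hθ), mulV_mul,
      ← inner_mulV_of_symm (invSqrt_transpose _), real_inner_smul_right, mul_comm, Param.rot]
  rw [norm_pow, this, ← mul_pow]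
  gcongr
  exact norm_inner_le_norm _ _

/-- The vectorized deviation `vec (X̃ X̃' - 1)`. -/
noncomputable def vecDev (θ : Param p) (z : EuclideanSpace ℝ (Fin p) × ℝ) :
    EuclideanSpace ℝ (Fin p × Fin p) :=
  WithLp.toLp 2 (outer (θ.rot z.1) - 1).vec

theorem continuous_vecDev (θ : Param p) : Continuous (vecDev θ) := by
  have h : Continuous fun z : EuclideanSpace ℝ (Fin p) × ℝ => outer (θ.rot z.1) :=
    continuous_outer.comp ((continuous_rot θ).comp continuous_fst)
  refine (PiLp.continuous_toLp 2 _).comp (continuous_pi fun q => ?_)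
  exact (h.sub continuous_const).matrix_elem _ _

theorem memLp_vecDev {θ : Param p} (hθ : θ ∈ modelSet p) : MemLp (vecDev θ) 2 θ.meas := by
  set c := specNorm (invSqrt θ.secondMoment)
  set c' := ‖WithLp.toLp 2 (1 : Matrix (Fin p) (Fin p) ℝ).vec‖
  have h2 : MemLp (fun z : EuclideanSpace ℝ (Fin p) × ℝ => ‖z.1‖ ^ 2) 2 θ.meas := by
    rw [memLp_two_iff_integrable_sq (by fun_prop)]
    refine hθ.2.2.1.congr (ae_of_all _ fun z => ?_)
    ring
  refine MemLp.mono' ((h2.const_mul (c ^ 2)).add (memLp_const c'))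
    (continuous_vecDev θ).aestronglyMeasurable (ae_of_all _ fun z => ?_)
  have hsub : vecDev θ z = WithLp.toLp 2 (outer (θ.rot z.1)).vec
      - WithLp.toLp 2 (1 : Matrix (Fin p) (Fin p) ℝ).vec := rfl
  rw [hsub]
  refine (norm_sub_le _ _).trans (add_le_add ?_ le_rfl)
  rw [norm_toLp_vec_outer]
  change _ ≤ c ^ 2 * ‖z.1‖ ^ 2
  rw [← mul_pow]
  gcongr
  exact norm_mulV_le_specNorm _ _

theorem integral_vecDev {θ : Param p} (hθ : θ ∈ modelSet p) : ∫ z, vecDev θ z ∂θ.meas = 0 := by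
  have hI := (memLp_vecDev hθ).integrable one_le_two
  ext ⟨j, i⟩
  rw [eval_integral_piLp fun q => hI.eval_piLp q]
  have h := integral_mul_mul_apply (integrable_outer hθ) (invSqrt θ.secondMoment)
    (invSqrt θ.secondMoment)ᵀ i j
  have hentry : ∀ z, vecDev θ z (j, i) = (invSqrt θ.secondMoment * outer z.1
      * (invSqrt θ.secondMoment)ᵀ) i j - (1 : Matrix (Fin p) (Fin p) ℝ) i j := by
    intro z
    rw [← outer_mulV]
    rfl
  simp only [hentry]
  rw [integral_sub h.1 (integrable_const _), h.2]
  have hM : (Matrix.of fun k l => ∫ z, outer z.1 k l ∂θ.meas) = θ.secondMoment := rfl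
  rw [hM, invSqrt_transpose, rot_mul_mul_rot hθ]
  simp

/-- Exhibits the Gram deviation as an average of i.i.d. vectors, centred by `integral_vecDev`. -/
theorem rotated_gram_sub_one {n : ℕ} (hn : 1 ≤ n) (θ : Param p)
    (z : Fin n → EuclideanSpace ℝ (Fin p) × ℝ) :
    WithLp.toLp 2 (invSqrt θ.secondMoment * gram z * invSqrt θ.secondMoment - 1).vec
      = (n : ℝ)⁻¹ • ∑ i, vecDev θ (z i) := by
  have hn0 : (n : ℝ) ≠ 0 := by exact_mod_cast (by omega : n ≠ 0)
  have h1 : invSqrt θ.secondMoment * gram z * invSqrt θ.secondMoment - 1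
      = (n : ℝ)⁻¹ • ∑ i, (outer (θ.rot (z i).1) - 1) := by
    simp only [Param.rot, outer_mulV, invSqrt_transpose, Finset.sum_sub_distrib, gram]
    rw [Matrix.mul_smul, Matrix.smul_mul, Matrix.mul_sum, Matrix.sum_mul, smul_sub,
      Finset.sum_const, Finset.card_univ, Fintype.card_fin, ← Nat.cast_smul_eq_nsmul ℝ, smul_smul,
      inv_mul_cancel₀ hn0, one_smul]
  rw [h1]
  ext ⟨j, i⟩
  simp only [vecDev, Matrix.vec, Matrix.sum_apply, Matrix.smul_apply, PiLp.smul_apply,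
    WithLp.ofLp_sum, Finset.sum_apply]

end Population

/-! ### Coverage -/

section Coverage

variable {p n : ℕ}

theorem integral_eval_pi {E G : Type*} [MeasurableSpace E] [NormedAddCommGroup G]
    [NormedSpace ℝ G] {P : Measure E} [IsProbabilityMeasure P] {f : E → G}
    (hf : AEStronglyMeasurable f P) (i : Fin n) :
    ∫ z : Fin n → E, f (z i) ∂(Measure.pi fun _ => P) = ∫ z, f z ∂P :=
  integral_comp_eval (μ := fun _ : Fin n => P) hf

/-! ### Moments of averages of i.i.d. centred vectors. -/

section Average

variable {E F : Type*} [MeasurableSpace E] {P : Measure E} [IsProbabilityMeasure P]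
  [NormedAddCommGroup F] [InnerProductSpace ℝ F] [CompleteSpace F] [MeasurableSpace F]
  [BorelSpace F] [SecondCountableTopology F] {Z : E → F}

theorem integral_norm_avg_sq_le (hn : 1 ≤ n) (hm : Measurable Z) (hL : MemLp Z 2 P)
    (h0 : ∫ x, Z x ∂P = 0) {k : ℝ} (hk : ∫ x, ‖Z x‖ ^ 2 ∂P ≤ k) :
    Integrable (fun z : Fin n → E => ‖(n : ℝ)⁻¹ • ∑ i, Z (z i)‖ ^ 2) (Measure.pi fun _ => P) ∧
    ∫ z : Fin n → E, ‖(n : ℝ)⁻¹ • ∑ i, Z (z i)‖ ^ 2 ∂(Measure.pi fun _ => P) ≤ k / n := by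
  have hn0 : (0 : ℝ) < n := by exact_mod_cast hn
  have hLi : ∀ i : Fin n, MemLp (fun z : Fin n → E => Z (z i)) 2 (Measure.pi fun _ => P) :=
    fun i => hL.comp_measurePreserving (measurePreserving_eval (fun _ : Fin n => P) i)
  have hind : iIndepFun (fun (i : Fin n) (z : Fin n → E) => Z (z i)) (Measure.pi fun _ => P) :=
    iIndepFun_pi (X := fun _ => Z) fun _ => hm.aemeasurable
  have h := integral_norm_sum_sq_of_iIndepFun hind (fun i => hm.comp (measurable_pi_apply i)) hLi
    (fun i => (integral_eval_pi hL.1 i).trans h0)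
    (fun i => (integral_eval_pi (f := fun x => ‖Z x‖ ^ 2) (hL.1.norm.pow 2) i).trans_le hk)
    Finset.univ
  have hSL : MemLp (∑ i, fun z : Fin n → E => Z (z i)) 2 (Measure.pi fun _ => P) :=
    memLp_finsetSum' Finset.univ fun i _ => hLi i
  have hS := integrable_norm_pow_of_memLp (k := 2) (m := 2) (by norm_num) le_rfl hSL
  simp only [Finset.sum_apply, Finset.card_univ, Fintype.card_fin] at h hS
  simp only [norm_smul, mul_pow]
  refine ⟨hS.const_mul _, ?_⟩
  rw [integral_const_mul, norm_inv, Real.norm_eq_abs, abs_of_pos hn0]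
  refine (mul_le_mul_of_nonneg_left h (by positivity)).trans (le_of_eq ?_)
  field_simp

theorem integral_norm_avg_pow_four_le (hn : 1 ≤ n) (hm : Measurable Z) (hL : MemLp Z 4 P)
    (h0 : ∫ x, Z x ∂P = 0) {k : ℝ} (hk : ∫ x, ‖Z x‖ ^ 4 ∂P ≤ k) :
    Integrable (fun z : Fin n → E => ‖(n : ℝ)⁻¹ • ∑ i, Z (z i)‖ ^ 4) (Measure.pi fun _ => P) ∧
    ∫ z : Fin n → E, ‖(n : ℝ)⁻¹ • ∑ i, Z (z i)‖ ^ 4 ∂(Measure.pi fun _ => P)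
      ≤ 3 * k / n ^ 2 := by
  have hn0 : (0 : ℝ) < n := by exact_mod_cast hn
  have hLi : ∀ i : Fin n, MemLp (fun z : Fin n → E => Z (z i)) 4 (Measure.pi fun _ => P) :=
    fun i => hL.comp_measurePreserving (measurePreserving_eval (fun _ : Fin n => P) i)
  have hind : iIndepFun (fun (i : Fin n) (z : Fin n → E) => Z (z i)) (Measure.pi fun _ => P) :=
    iIndepFun_pi (X := fun _ => Z) fun _ => hm.aemeasurable
  have h := integral_norm_sum_pow_four_of_iIndepFun hind
    (fun i => hm.comp (measurable_pi_apply i)) hLi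
    (fun i => (integral_eval_pi hL.1 i).trans h0)
    (fun i => (integral_eval_pi (f := fun x => ‖Z x‖ ^ 4) (hL.1.norm.pow 4) i).trans_le hk)
    Finset.univ
  have hSL : MemLp (∑ i, fun z : Fin n → E => Z (z i)) 4 (Measure.pi fun _ => P) :=
    memLp_finsetSum' Finset.univ fun i _ => hLi i
  have hS := integrable_norm_pow_of_memLp (k := 4) (m := 4) (by norm_num) le_rfl hSL
  simp only [Finset.sum_apply, Finset.card_univ, Fintype.card_fin] at h hS
  simp only [norm_smul, mul_pow]
  refine ⟨hS.const_mul _, ?_⟩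
  rw [integral_const_mul, norm_inv, Real.norm_eq_abs, abs_of_pos hn0]
  refine (mul_le_mul_of_nonneg_left h (by positivity)).trans (le_of_eq ?_)
  field_simp

end Average

/-! ### Probabilities of the four exceptional events. -/

theorem measureReal_gram_dev_le (hn : 1 ≤ n) {θ : Param p} (hθ : θ ∈ modelSet p) {K : Bounds}
    (hReg : 0 < K.KReg) {γ : ℝ} (hγ : 0 < γ)
    (hk : ∫ z, ‖vecDev θ z‖ ^ 2 ∂θ.meas ≤ K.KReg) :
    (Measure.pi fun _ : Fin n => θ.meas).real {z | gammaTilde K n γ < ‖WithLp.toLp 2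
      (invSqrt θ.secondMoment * gram z * invSqrt θ.secondMoment - 1).vec‖} ≤ γ := by
  have hn0 : (0 : ℝ) < n := by exact_mod_cast hn
  simp only [rotated_gram_sub_one hn]
  obtain ⟨hI, hle⟩ := integral_norm_avg_sq_le hn (continuous_vecDev θ).measurable
    (memLp_vecDev hθ) (integral_vecDev hθ) hk
  have hg2 : gammaTilde K n γ ^ 2 = K.KReg / (n * γ) := Real.sq_sqrt (by positivity)
  have hM := (mul_meas_ge_le_integral_of_nonneg (ae_of_all _ fun z => by positivity) hI
    (gammaTilde K n γ ^ 2)).trans hle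
  refine (measureReal_mono fun z hz => ?_).trans (?_ : (Measure.pi fun _ : Fin n => θ.meas).real
    {z | gammaTilde K n γ ^ 2 ≤ ‖(n : ℝ)⁻¹ • ∑ i, vecDev θ (z i)‖ ^ 2} ≤ γ)
  · exact pow_le_pow_left₀ (Real.sqrt_nonneg _) (le_of_lt hz) 2
  · have h0 : 0 < K.KReg / (n * γ) := by positivity
    rw [hg2] at hM ⊢
    refine le_of_mul_le_mul_left (hM.trans (le_of_eq ?_)) h0
    field_simp

theorem measureReal_score_le (hn : 1 ≤ n) {θ : Param p} (hθ : θ ∈ modelSet p) {k : ℝ}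
    (hk0 : 0 < k) {γ : ℝ} (hγ : 0 < γ)
    (hI : Integrable (fun z => ‖z.2 • θ.rot z.1‖ ^ 4) θ.meas)
    (hk : ∫ z, ‖z.2 • θ.rot z.1‖ ^ 4 ∂θ.meas ≤ k) :
    (Measure.pi fun _ : Fin n => θ.meas).real {z | √2 * (k / γ) ^ (1 / 4 : ℝ) / √(n : ℝ)
      < ‖(n : ℝ)⁻¹ • ∑ i, (z i).2 • θ.rot (z i).1‖} ≤ γ := by
  have hn0 : (0 : ℝ) < n := by exact_mod_cast hn
  have hc := continuous_rot θ
  have hm : Measurable fun z : EuclideanSpace ℝ (Fin p) × ℝ => z.2 • θ.rot z.1 :=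
    (by fun_prop : Continuous fun z : EuclideanSpace ℝ (Fin p) × ℝ => z.2 • θ.rot z.1).measurable
  obtain ⟨hI', hle⟩ := integral_norm_avg_pow_four_le hn hm (memLp_smul_rot hI)
    (integral_smul_rot hθ) hk
  set r := √2 * (k / γ) ^ (1 / 4 : ℝ) / √(n : ℝ) with hr
  have hr0 : 0 ≤ r := by positivity
  -- The factor `√2` contributes `4`, while the moment bound has only `3`; Markov thus gives `3γ/4`,
  -- rounded up to `γ`.
  have hr4 : r ^ 4 = 4 * k / (n ^ 2 * γ) := by
    have h1 : r ^ 4 = (√2 ^ 2) ^ 2 * (((k / γ) ^ (1 / 4 : ℝ)) ^ 2) ^ 2 / (√(n : ℝ) ^ 2) ^ 2 := by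
      rw [hr]; ring
    rw [h1, rpow_quarter_sq (by positivity), Real.sq_sqrt (by norm_num),
      Real.sq_sqrt (by positivity),
      Real.sq_sqrt hn0.le]
    field_simp
    norm_num
  have hM := (mul_meas_ge_le_integral_of_nonneg (ae_of_all _ fun z => by positivity) hI'
    (r ^ 4)).trans hle
  refine (measureReal_mono fun z hz => ?_).trans (?_ : (Measure.pi fun _ : Fin n => θ.meas).real
    {z | r ^ 4 ≤ ‖(n : ℝ)⁻¹ • ∑ i, (z i).2 • θ.rot (z i).1‖ ^ 4} ≤ γ)
  · exact pow_le_pow_left₀ hr0 (le_of_lt hz) 4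
  · have h0 : 0 < 4 * k / (n ^ 2 * γ) := by positivity
    rw [hr4] at hM ⊢
    refine le_of_mul_le_mul_left (hM.trans ?_) h0
    have : 4 * k / (n ^ 2 * γ) * γ = 4 * k / n ^ 2 := by field_simp
    rw [this]
    gcongr
    norm_num

theorem measureReal_sum_xi_sq_le (hn : 1 ≤ n) {θ : Param p} (hθ : θ ∈ modelSet p)
    {u : EuclideanSpace ℝ (Fin p)} (hu : u ≠ 0) {k a : ℝ} (hk0 : 0 < k) (ha : 1 < a)
    (hI : Integrable (fun z => θ.xi u z ^ 4) θ.meas)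
    (hk : (∫ z, θ.xi u z ^ 4 ∂θ.meas) / (∫ z, θ.xi u z ^ 2 ∂θ.meas) ^ 2 ≤ k) :
    (Measure.pi fun _ : Fin n => θ.meas).real
      {z | (n : ℝ)⁻¹ * ∑ i, θ.xi u (z i) ^ 2 < (∫ z, θ.xi u z ^ 2 ∂θ.meas) / a}
      ≤ Real.exp (-(n * (1 - 1 / a) ^ 2) / (2 * k)) := by
  have hn0 : (0 : ℝ) < n := by exact_mod_cast hn
  have hv := integral_xi_sq_pos hθ hu
  have hc := continuous_xi θ u
  set v := ∫ z, θ.xi u z ^ 2 ∂θ.meas with hvdef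
  rw [div_le_iff₀ (by positivity)] at hk
  -- A Bochner integral that is not zero certifies integrability.
  have hI2 : Integrable (fun z => θ.xi u z ^ 2) θ.meas :=
    Integrable.of_integral_ne_zero hv.ne'
  have hmp := fun i : Fin n => measurePreserving_eval (fun _ : Fin n => θ.meas) i
  have hind : iIndepFun (fun (i : Fin n) (z : Fin n → EuclideanSpace ℝ (Fin p) × ℝ) =>
      θ.xi u (z i) ^ 2) (Measure.pi fun _ => θ.meas) :=
    iIndepFun_pi (X := fun _ z => θ.xi u z ^ 2) fun _ => by fun_prop
  have hI22 : Integrable (fun z => (θ.xi u z ^ 2) ^ 2) θ.meas :=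
    hI.congr (ae_of_all _ fun z => by ring)
  -- Since `μ - t = v / a` and `t² / m = (1 - 1/a)² / k`, the scale `v` leaves the exponent.
  have hmain := measureReal_sum_le_of_nonneg hind (fun i => by fun_prop)
    (fun i z => sq_nonneg _) (fun i => (hmp i).integrable_comp_of_integrable hI2)
    (fun i => (hmp i).integrable_comp_of_integrable hI22) (μ := v) (m := k * v ^ 2)
    (t := v * (1 - 1 / a))
    (fun i => integral_eval_pi (f := fun z => θ.xi u z ^ 2) hI2.1 i)
    (fun i => (integral_eval_pi (f := fun z => (θ.xi u z ^ 2) ^ 2) hI22.1 i).trans_le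
      (le_trans (le_of_eq (integral_congr_ae (ae_of_all _ fun z => by ring))) hk))
    (by positivity)
    (mul_nonneg hv.le (sub_nonneg.2 ((div_le_one (by linarith)).2 ha.le)))
  rw [Fintype.card_fin] at hmain
  refine (measureReal_mono fun z hz => ?_).trans (hmain.trans (le_of_eq ?_))
  · change (n : ℝ)⁻¹ * _ < _ at hz
    rw [inv_mul_lt_iff₀ hn0] at hz
    change _ ≤ (n : ℝ) * (v - v * (1 - 1 / a))
    refine hz.le.trans (le_of_eq ?_)
    ring
  · congr 1
    field_simp

theorem sigma_xiLaw {θ : Param p} (hθ : θ ∈ modelSet p) (u : EuclideanSpace ℝ (Fin p)) :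
    sigma (θ.xiLaw u) = √(∫ z, θ.xi u z ^ 2 ∂θ.meas) := by
  have hm := (continuous_xi θ u).measurable
  rw [sigma, Param.xiLaw, variance_map aemeasurable_id hm.aemeasurable,
    Function.id_comp, variance_of_integral_eq_zero hm.aemeasurable (integral_xi hθ u)]

theorem cdfStdSum_xiLaw {θ : Param p} (hθ : θ ∈ modelSet p) (u : EuclideanSpace ℝ (Fin p))
    (x : ℝ) : cdfStdSum n (θ.xiLaw u) x = (Measure.pi fun _ : Fin n => θ.meas).real
      {z | (∑ i, θ.xi u (z i)) / (√(∫ z, θ.xi u z ^ 2 ∂θ.meas) * √(n : ℝ)) ≤ x} := by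
  have hm := (continuous_xi θ u).measurable
  have : IsProbabilityMeasure (θ.meas.map (θ.xi u)) :=
    Measure.isProbabilityMeasure_map hm.aemeasurable
  have h0 : ∫ w, w ∂(θ.xiLaw u) = 0 := by
    rw [Param.xiLaw, integral_map hm.aemeasurable (by fun_prop), integral_xi hθ u]
  rw [cdfStdSum, sigma_xiLaw hθ, h0, Param.xiLaw,
    ← Measure.pi_map_pi (f := fun _ => θ.xi u) fun _ => hm.aemeasurable,
    map_measureReal_apply (by fun_prop) (measurableSet_le (by fun_prop) (by fun_prop))]
  simp only [sub_zero]
  rfl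

theorem measureReal_abs_sum_xi_gt_le {θ : Param p} (hθ : θ ∈ modelSet p)
    {u : EuclideanSpace ℝ (Fin p)} {δ τ : ℝ}
    (hδ : min (deltaE n (θ.xiLaw u)) (deltaB n (θ.xiLaw u)) ≤ δ) (hτ0 : 0 < τ) (hτ1 : τ < 1) :
    (Measure.pi fun _ : Fin n => θ.meas).real {z | gaussQuantile τ
      < |(∑ i, θ.xi u (z i)) / (√(∫ z, θ.xi u z ^ 2 ∂θ.meas) * √(n : ℝ))|}
      ≤ 2 * (1 - τ) + 2 * δ := by
  have hm := (continuous_xi θ u).measurable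
  have : IsProbabilityMeasure (θ.xiLaw u) := Measure.isProbabilityMeasure_map hm.aemeasurable
  set q := gaussQuantile τ
  set S := fun z : Fin n → EuclideanSpace ℝ (Fin p) × ℝ =>
    (∑ i, θ.xi u (z i)) / (√(∫ z, θ.xi u z ^ 2 ∂θ.meas) * √(n : ℝ)) with hS
  have hSm : Measurable S := by fun_prop
  have h1 := cdfStdSum_sub_ge n (θ.xiLaw u) q
  rw [cdfStdSum_xiLaw hθ, cdfStdSum_xiLaw hθ, Phi_neg] at h1
  have h2 := Phi_gaussQuantile hτ0 hτ1
  have h3 : (Measure.pi fun _ : Fin n => θ.meas).real {z | q < |S z|}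
      ≤ (Measure.pi fun _ : Fin n => θ.meas).real {z | S z ≤ q}ᶜ
        + (Measure.pi fun _ : Fin n => θ.meas).real {z | S z ≤ -q} := by
    refine (measureReal_mono fun z hz => ?_).trans (measureReal_union_le _ _)
    rcases lt_abs.1 (show q < |S z| from hz) with h | h
    · exact Or.inl (not_le.2 h)
    -- Enlarging `S < -q` to `S ≤ -q` makes the distribution function at `-q` appear, with no left
    -- limit.
    · exact Or.inr (show S z ≤ -q by linarith)
  rw [probReal_compl_eq_one_sub (measurableSet_le hSm measurable_const)] at h3
  linarith

/-- As `n₀` is a supremum, an `n` above it cannot itself belong to the set of bad indices. -/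
theorem lt_and_nuEdg_lt_of_not_le_n0 {α : ℝ} {K : Bounds} {t : Tuning} (hn : 1 ≤ n)
    (h : ¬(n : ℕ∞) ≤ n0 α K t) :
    2 * K.KReg / (t.omega n * α) < n ∧ nuEdg α K t n < α / 2 := by
  by_contra hcon
  refine h (le_iSup₂_of_le n ⟨hn, ?_⟩ le_rfl)
  by_contra hor
  exact hcon ⟨not_le.1 fun h1 => hor (Or.inl h1), not_le.1 fun h2 => hor (Or.inr h2)⟩

/-- Coverage holds outside the four exceptional events. -/
theorem mem_CIEdg_of_good (hn : 1 ≤ n) {θ : Param p} (hθ : θ ∈ modelSet p)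
    {u : EuclideanSpace ℝ (Fin p)} (hu : u ≠ 0) {α : ℝ} {K : Bounds} {t : Tuning}
    (hlam : 0 < K.lamReg) (hReg : 0 < K.KReg) (hEps : 0 < K.KEps) (ha : 1 < t.a n)
    (hmin : K.lamReg ≤ lamMin θ.secondMoment) (hγ : 0 < t.omega n * α / 2)
    (hg : gammaTilde K n (t.omega n * α / 2) < 1)
    (hq : 0 ≤ gaussQuantile (1 - α / 2 + nuEdg α K t n))
    {z : Fin n → EuclideanSpace ℝ (Fin p) × ℝ}
    (hA : ‖WithLp.toLp 2 (invSqrt θ.secondMoment * gram z * invSqrt θ.secondMoment - 1).vec‖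
      ≤ gammaTilde K n (t.omega n * α / 2))
    (hB : ‖(n : ℝ)⁻¹ • ∑ i, (z i).2 • θ.rot (z i).1‖
      ≤ √2 * (K.KEps / (t.omega n * α / 2)) ^ (1 / 4 : ℝ) / √(n : ℝ))
    (hC : (∫ z, θ.xi u z ^ 2 ∂θ.meas) / t.a n ≤ (n : ℝ)⁻¹ * ∑ i, θ.xi u (z i) ^ 2)
    (hS : |(∑ i, θ.xi u (z i)) / (√(∫ z, θ.xi u z ^ 2 ∂θ.meas) * √(n : ℝ))|
      ≤ gaussQuantile (1 - α / 2 + nuEdg α K t n)) :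
    inner ℝ u θ.beta ∈ CIEdg u α K t fun i => observe θ.beta (z i) := by
  have hn0 : (0 : ℝ) < n := by exact_mod_cast hn
  set γ := t.omega n * α / 2 with hγdef
  set q := gaussQuantile (1 - α / 2 + nuEdg α K t n)
  set D := fun i => observe θ.beta (z i) with hD
  have hv := integral_xi_sq_pos hθ hu
  set v := ∫ z, θ.xi u z ^ 2 ∂θ.meas
  obtain ⟨h1, h2⟩ := linearization (u := u) (β := θ.beta) hlam (invSqrt_transpose _)
    (rot_mul_mul_rot hθ)
    (fun w => (mul_le_mul_of_nonneg_right hmin (by positivity)).trans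
      (lamMin_mul_le_inner (secondMoment_transpose θ) w))
    (g := gammaTilde K n γ) (Real.sqrt_nonneg _) hg hA hB
  rw [RLin_div_sqrt] at h1
  have hvar : v / t.a n ≤ enlargedVar D u K γ := by
    refine hC.trans (h2.trans (le_of_eq ?_))
    rw [enlargedVar, ← RVar_eq D K hn hlam hReg hEps hγ]
    rfl
  -- The unknown standard deviation is replaced by an observable one; multiplying by the quantile
  -- later preserves the inequality because `0 ≤ q`.
  have hs : √v ≤ √(t.a n) * √(enlargedVar D u K γ) := by
    rw [← Real.sqrt_mul (by linarith)]
    apply Real.sqrt_le_sqrt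
    rw [div_le_iff₀ (by linarith)] at hvar
    linarith
  have hsv : 0 < √v := Real.sqrt_pos.2 hv
  have hsn : 0 < √(n : ℝ) := Real.sqrt_pos.2 hn0
  have hmean : |(n : ℝ)⁻¹ * ∑ i, θ.xi u (z i)|
      ≤ √(t.a n) * q * √(enlargedVar D u K γ) / √(n : ℝ) := by
    rw [abs_div, abs_of_pos (mul_pos hsv hsn), div_le_iff₀ (by positivity)] at hS
    rw [abs_mul, abs_of_pos (inv_pos.2 hn0), le_div_iff₀ hsn]
    have hnn : (n : ℝ)⁻¹ = (√(n : ℝ) * √(n : ℝ))⁻¹ := by rw [Real.mul_self_sqrt hn0.le]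
    calc (n : ℝ)⁻¹ * |∑ i, θ.xi u (z i)| * √(n : ℝ)
        ≤ (n : ℝ)⁻¹ * (q * (√v * √(n : ℝ))) * √(n : ℝ) := by gcongr
      _ = q * √v := by rw [hnn]; field_simp
      _ ≤ q * (√(t.a n) * √(enlargedVar D u K γ)) := by gcongr
      _ = _ := by ring
  have hhalf : halfWidth u α K t D = √(t.a n) * q * √(enlargedVar D u K γ) / √(n : ℝ)
      + RLin u K n γ / √(n : ℝ) := by
    rw [halfWidth, ← add_div]
  have h3 := abs_le.1 h1
  have h4 := abs_le.1 hmean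
  change -_ ≤ _ - (n : ℝ)⁻¹ * ∑ i, θ.xi u (z i) ∧ _ - (n : ℝ)⁻¹ * ∑ i, θ.xi u (z i) ≤ _ at h3
  rw [CIEdg]
  split_ifs
  · trivial
  · rw [hhalf]
    constructor <;> linarith [h3.1, h3.2, h4.1, h4.2]

theorem obsLaw_eq (θ : Param p) : θ.obsLaw = θ.meas.map (observe θ.beta) := rfl

theorem measurable_observe (β : EuclideanSpace ℝ (Fin p)) : Measurable (observe β) := by
  unfold observe
  fun_prop

end Coverage

end OLS

/-! ### The union bound. -/

theorem mainTheorem1 {p : ℕ} (u : EuclideanSpace ℝ (Fin p)) (hu : u ≠ 0)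
    (K : OLS.Bounds) (hlam : 0 < K.lamReg) (hReg : 0 < K.KReg) (hEps : 0 < K.KEps)
    (hXi : 0 < K.KXi) (α : ℝ) (hα : α ∈ Set.Ioo (0 : ℝ) 1) (t : OLS.Tuning)
    (n : ℕ) (hn : 1 ≤ n)
    (hδ : ∀ θ ∈ OLS.thetaEE u K,
      min (OLS.deltaE n (θ.xiLaw u)) (OLS.deltaB n (θ.xiLaw u)) ≤ t.delta n)
    (ha : 1 < t.a n) (hω : t.omega n ∈ Set.Ioo (0 : ℝ) 1) :
    OLS.IsValidConfidenceSet OLS.Param.obsLaw (fun θ => inner ℝ u θ.beta) (OLS.thetaEE u K)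
      (1 - α) n (OLS.CIEdg u α K t) := by
  intro θ hθ
  have hmeas := OLS.measurableSet_mem_CIEdg (n := n) u α K t (inner ℝ u θ.beta)
  refine ⟨hmeas, ?_⟩
  obtain ⟨hmod, hmin, hreg, ⟨hepsI, heps⟩, hxi⟩ := id hθ
  have hobs := OLS.measurable_observe θ.beta
  have hprob : IsProbabilityMeasure (θ.meas.map (OLS.observe θ.beta)) :=
    Measure.isProbabilityMeasure_map hobs.aemeasurable
  have hpre : (Measure.pi fun _ : Fin n => θ.obsLaw).real
      {D | inner ℝ u θ.beta ∈ OLS.CIEdg u α K t D}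
      = (Measure.pi fun _ : Fin n => θ.meas).real
        {z | inner ℝ u θ.beta ∈ OLS.CIEdg u α K t fun i => OLS.observe θ.beta (z i)} := by
    simp only [OLS.obsLaw_eq]
    rw [← Measure.pi_map_pi (f := fun _ => OLS.observe θ.beta) fun _ => hobs.aemeasurable,
      map_measureReal_apply (by fun_prop) hmeas]
    rfl
  rw [hpre]
  by_cases hcase : (n : ℕ∞) ≤ OLS.n0 α K t
  · have : {z : Fin n → EuclideanSpace ℝ (Fin p) × ℝ | inner ℝ u θ.beta
        ∈ OLS.CIEdg u α K t fun i => OLS.observe θ.beta (z i)} = Set.univ := by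
      ext z
      simp [OLS.CIEdg, hcase]
    rw [this, probReal_univ]
    linarith [hα.1]
  obtain ⟨hnK, hν⟩ := OLS.lt_and_nuEdg_lt_of_not_le_n0 hn hcase
  have hn0 : (0 : ℝ) < n := by exact_mod_cast hn
  have hωα : 0 < t.omega n * α := mul_pos hω.1 hα.1
  have hγ : 0 < t.omega n * α / 2 := by positivity
  -- `K_reg / (nγ) < 1` is the first threshold condition, `n > 2 K_reg / (ω_n α)`.
  have hg : OLS.gammaTilde K n (t.omega n * α / 2) < 1 := by
    rw [OLS.gammaTilde, Real.sqrt_lt' one_pos, one_pow, div_lt_one (by positivity)]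
    rw [div_lt_iff₀ hωα] at hnK
    linarith
  -- Makes `ν_n` positive, which with `α < 1` puts the quantile order above `1/2`; `ν_n < α/2` keeps
  -- it below `1`.
  have hδ0 : 0 ≤ t.delta n := by
    refine le_trans (le_min ?_ ?_) (hδ θ hθ) <;> exact Real.iSup_nonneg fun x => abs_nonneg _
  set E := Real.exp (-(n * (1 - 1 / t.a n) ^ 2) / (2 * K.KXi)) with hE
  have hνeq : OLS.nuEdg α K t n = (t.omega n * α + E) / 2 + t.delta n := rfl
  have hE0 : 0 < E := Real.exp_pos _
  have hτ1 : 1 - α / 2 + OLS.nuEdg α K t n < 1 := by linarith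
  have hτ0 : 1 / 2 < 1 - α / 2 + OLS.nuEdg α K t n := by linarith [hα.2]
  have hpA := OLS.measureReal_gram_dev_le hn hmod hReg hγ hreg
  have hpB := OLS.measureReal_score_le hn hmod hEps hγ hepsI heps
  have hpC := OLS.measureReal_sum_xi_sq_le hn hmod hu hXi ha
    (OLS.integrable_xi_pow_four hmod hepsI u) hxi
  have hpS := OLS.measureReal_abs_sum_xi_gt_le hmod (hδ θ hθ) (by linarith) hτ1
  rw [← hE] at hpC
  set P := Measure.pi fun _ : Fin n => θ.meas
  set G := {z : Fin n → EuclideanSpace ℝ (Fin p) × ℝ | inner ℝ u θ.beta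
    ∈ OLS.CIEdg u α K t fun i => OLS.observe θ.beta (z i)} with hG
  have hGm : MeasurableSet G :=
    (by fun_prop : Measurable fun (z : Fin n → EuclideanSpace ℝ (Fin p) × ℝ) i =>
      OLS.observe θ.beta (z i)) hmeas
  -- The right-hand side equals `α`, because `2ν_n = ω_n α + E + 2δ_n`.
  have hcompl : P.real Gᶜ ≤ t.omega n * α / 2 + t.omega n * α / 2 + E
      + (2 * (1 - (1 - α / 2 + OLS.nuEdg α K t n)) + 2 * t.delta n) := by
    refine le_trans ?_ (add_le_add (add_le_add (add_le_add hpA hpB) hpC) hpS)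
    refine le_trans ?_ (add_le_add_left ((measureReal_union_le _ _).trans
      (add_le_add_left (measureReal_union_le _ _) _)) _)
    refine le_trans (measureReal_mono fun z hz => ?_) (measureReal_union_le _ _)
    by_contra hbad
    simp only [Set.mem_union, Set.mem_ofPred_eq, not_or, not_lt] at hbad
    obtain ⟨⟨⟨hA, hB⟩, hC⟩, hS⟩ := hbad
    exact hz (OLS.mem_CIEdg_of_good hn hmod hu hlam hReg hEps ha hmin hγ hg
      (OLS.gaussQuantile_nonneg hτ0 hτ1) hA hB hC hS)
  rw [probReal_compl_eq_one_sub hGm] at hcompl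
  linarith
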